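/- Let $\mu$ be an absolutely continuous probability measure on $\mathbb{R}$ with $\mu([0,1])=1$, and let $q_1,q_2>0$ with $q_1+q_2<1$. Consider $n\ge 1$ agents at positions $\vec x=(x_1,\dots,x_n)$ and two facilities at positions $\vec y=(y_1,y_2)\in[0,1]^2$, where facility $j$ can accommodate $\lfloor q_j n\rfloor$ agents. In the First-Come-First-Served game each agent $i$ selects a facility $s_i\in\{1,2\}$; among the agents that selected facility $j$, the $\lfloor q_jn\rfloor$ closest to $y_j$ (ties broken by smaller index) are accommodated and get utility $1-|x_i-y_j|$, and the other agents get utility $0$. The Social Welfare of a strategy profile is the sum of all utilities. Let $SW_{opt}(\vec x)$ be the supremum of the Social Welfare over all $\vec y\in[0,1]^2$ and all pure Nash equilibria of the game at $\vec y$. For $\vec p=(p_1,p_2)\in[0,1]^2$, the percentile mechanism $\mathcal{PM}_{\vec p}$ places facility $j$ at the position of the $(\lfloor p_j(n-1)\rfloor+1)$-th agent from the left. It is Equilibrium Stable (ES) if for every $n\ge1$ and every $\vec x\in[0,1]^n$ all pure Nash equilibria of the game at $\mathcal{PM}_{\vec p}(\vec x)$ have the same Social Welfare, which is then denoted $SW_{\vec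 p}(\vec x)$. An ES percentile mechanism is asymptotically optimal for $\mu$ if $$\lim_{n\to\infty}\frac{\mathbb{E}[SW_{opt}(\vec X_n)]}{\mathbb{E}[SW_{\vec p}(\vec X_n)]}=1,$$ where $\vec X_n=(X_1,\dots,X_n)$ has independent components with law $\mu$. If $q_1+q_2>\frac23$, then no Equilibrium Stable percentile mechanism is asymptotically optimal for $\mu$. -/

import Mathlib

open MeasureTheory Filter Topology

/-! ### The First-Come-First-Served game

`n` agents sit at `x : Fin n → ℝ`, `m` facilities at `y : Fin m → ℝ`, and facility `j` accommodates
at most `⌊q j * n⌋` agents.  A strategy profile `s : Fin n → Fin m` says which facility each agent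
selects. -/

/-- The number of agents that facility `j` can accommodate when there are `n` agents. -/
noncomputable def capacity {m : ℕ} (q : Fin m → ℝ) (n : ℕ) (j : Fin m) : ℕ :=
  ⌊q j * (n : ℝ)⌋₊

/-- The number of agents that selected the same facility as agent `i` and come before `i` there:
they are closer to the facility, or equally close with a smaller index. -/
noncomputable def queuePosition {n m : ℕ} (x : Fin n → ℝ) (y : Fin m → ℝ) (s : Fin n → Fin m)
    (i : Fin n) : ℕ :=
  (Finset.univ.filter fun k : Fin n =>
    s k = s i ∧ (|x k - y (s i)| < |x i - y (s i)| ∨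
      (|x k - y (s i)| = |x i - y (s i)| ∧ k < i))).card

/-- The utility of agent `i` under the strategy profile `s`. -/
noncomputable def utility {n m : ℕ} (q : Fin m → ℝ) (x : Fin n → ℝ) (y : Fin m → ℝ)
    (s : Fin n → Fin m) (i : Fin n) : ℝ :=
  if queuePosition x y s i < capacity q n (s i) then 1 - |x i - y (s i)| else 0

/-- Pure Nash equilibria of the First-Come-First-Served game. -/
def IsNashEquilibrium {n m : ℕ} (q : Fin m → ℝ) (x : Fin n → ℝ) (y : Fin m → ℝ)
    (s : Fin n → Fin m) : Prop :=
  ∀ (i : Fin n) (j : Fin m), utility q x y (Function.update s i j) i ≤ utility q x y s i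

/-- The Social Welfare of the facility positions `y` under the strategy profile `s`. -/
noncomputable def socialWelfare {n m : ℕ} (q : Fin m → ℝ) (x : Fin n → ℝ) (y : Fin m → ℝ)
    (s : Fin n → Fin m) : ℝ :=
  ∑ i, utility q x y s i

/-- The Social Welfare of `y`: the largest value over the Nash equilibria (a finite set).  It is the
common value whenever all the equilibria have the same Social Welfare. -/
noncomputable def welfareAt {n m : ℕ} (q : Fin m → ℝ) (x : Fin n → ℝ) (y : Fin m → ℝ) : ℝ :=
  sSup {w | ∃ s : Fin n → Fin m, IsNashEquilibrium q x y s ∧ w = socialWelfare q x y s}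

/-- The optimal Social Welfare for the agents `x`, over all facility positions in `[0,1]` and all
Nash equilibria that these induce. -/
noncomputable def optimalWelfare {n m : ℕ} (q : Fin m → ℝ) (x : Fin n → ℝ) : ℝ :=
  sSup {w | ∃ y : Fin m → ℝ, (∀ j, y j ∈ Set.Icc (0 : ℝ) 1) ∧
    ∃ s : Fin n → Fin m, IsNashEquilibrium q x y s ∧ w = socialWelfare q x y s}

/-! ### Percentile mechanisms -/

/-- With `n + 1` agents, the `(⌊p * n⌋ + 1)`-th agent from the left has (0-based) rank `⌊p * n⌋`. -/
noncomputable def percentileRank (n : ℕ) (p : unitInterval) : Fin (n + 1) :=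
  ⟨⌊(p : ℝ) * (n : ℝ)⌋₊, Nat.lt_succ_of_le <| Nat.floor_le_of_le <|
    mul_le_of_le_one_left (Nat.cast_nonneg n) p.2.2⟩

/-- The percentile mechanism for `n + 1` agents: facility `j` is placed at the position of the
`(⌊p j * n⌋ + 1)`-th agent from the left. -/
noncomputable def percentileMechanism {n m : ℕ} (p : Fin m → unitInterval) (x : Fin (n + 1) → ℝ) :
    Fin m → ℝ :=
  fun j => x (Tuple.sort x (percentileRank n (p j)))

/-- The percentile mechanism of `p` is Equilibrium Stable: for every number of agents and all agents'
positions in `[0,1]`, all the Nash equilibria induced by its output have the same Social Welfare. -/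
def IsEquilibriumStable {m : ℕ} (q : Fin m → ℝ) (p : Fin m → unitInterval) : Prop :=
  ∀ (n : ℕ) (x : Fin (n + 1) → ℝ), (∀ i, x i ∈ Set.Icc (0 : ℝ) 1) →
    ∀ s t : Fin (n + 1) → Fin m,
      IsNashEquilibrium q x (percentileMechanism p x) s →
      IsNashEquilibrium q x (percentileMechanism p x) t →
        socialWelfare q x (percentileMechanism p x) s =
          socialWelfare q x (percentileMechanism p x) t

/-- The Bayesian approximation ratio of the percentile mechanism of `p` for `n + 1` agents whose
positions are independent with law `μ`. -/
noncomputable def bayesianRatio {m : ℕ} (μ : Measure ℝ) (q : Fin m → ℝ) (p : Fin m → unitInterval)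
    (n : ℕ) : ℝ :=
  (∫ x : Fin (n + 1) → ℝ, optimalWelfare q x ∂(Measure.pi fun _ => μ)) /
    ∫ x : Fin (n + 1) → ℝ, welfareAt q x (percentileMechanism p x) ∂(Measure.pi fun _ => μ)

/-- Asymptotic optimality: the Bayesian approximation ratio tends to `1` as the number of agents
tends to infinity. -/
def IsAsymptoticallyOptimal {m : ℕ} (μ : Measure ℝ) (q : Fin m → ℝ) (p : Fin m → unitInterval) :
    Prop :=
  Tendsto (bayesianRatio μ q p) atTop (𝓝 1)

/-! Equilibrium Stability restricts the percentiles. If p_a < p_b and p_b - p_a < q_1 + q_2, then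
for some large n there is an input with an agent equidistant from the two facilities, whose
indifferent choice changes the welfare: it decides which of two distant agents is accommodated, or
which facility a distant agent gets. Hence either p_1 = p_2 or p_b - p_a ≥ q_1 + q_2
(`IsEquilibriumStable.add_le_sub`).

In both cases a displacement of size δ improves the mechanism's placement by order δ n, provided
that windows of length 2δ contain few agents. If the facilities coincide, both move to the side with
many more accommodated agents, or, when the sides are balanced, they move apart
(`exists_stable_gain_of_common`). If they are far apart, the outer agents make up at most a fraction
1 - (q_1 + q_2) of all, which is less than (q_1 + q_2) / 2 because q_1 + q_2 > 2/3. So some facility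
has more than half of its closest agents on the inner side and should move inward
(`exists_stable_gain_of_apart`). Equilibria at the new placement come from stable matchings
(`IsStable.exists_nash`), so it suffices to bound the welfare of one stable matching.

The admissible density η of agents in a window does not depend on δ (`HasUniformGain`). Absolute
continuity therefore allows δ to be chosen after η so that windows are sparse in mean square for all
large n. The expected gain is then at least a constant times n, while the welfare is at most the
number of agents, so the ratio stays away from 1 (`HasUniformGain.not_isAsymptoticallyOptimal`). -/

/-! ### Stable matchings -/

/-- Agent `k` comes before agent `i` at a facility placed at `u`. -/
def Precedes {n : ℕ} (x : Fin n → ℝ) (u : ℝ) (k i : Fin n) : Prop :=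
  |x k - u| < |x i - u| ∨ (|x k - u| = |x i - u| ∧ k < i)

theorem Precedes.dist_le {n : ℕ} {x : Fin n → ℝ} {u : ℝ} {k i : Fin n} (h : Precedes x u k i) :
    |x k - u| ≤ |x i - u| := by
  rcases h with h | h
  · exact h.le
  · exact h.1.le

theorem Precedes.ne {n : ℕ} {x : Fin n → ℝ} {u : ℝ} {k i : Fin n} (h : Precedes x u k i) :
    k ≠ i := by
  rintro rfl
  rcases h with h | h
  · exact lt_irrefl _ h
  · exact lt_irrefl _ h.2

theorem Precedes.trans {n : ℕ} {x : Fin n → ℝ} {u : ℝ} {k i l : Fin n} (h : Precedes x u k i)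
    (h' : Precedes x u i l) : Precedes x u k l := by
  rcases h with h | h <;> rcases h' with h' | h'
  · exact Or.inl (h.trans h')
  · exact Or.inl (h.trans_eq h'.1)
  · exact Or.inl (h.1.trans_lt h')
  · exact Or.inr ⟨h.1.trans h'.1, h.2.trans h'.2⟩

theorem Precedes.asymm {n : ℕ} {x : Fin n → ℝ} {u : ℝ} {k i : Fin n} (h : Precedes x u k i) :
    ¬ Precedes x u i k := fun h' => (h.trans h').ne rfl

theorem precedes_or_precedes {n : ℕ} (x : Fin n → ℝ) (u : ℝ) {k i : Fin n} (h : k ≠ i) :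
    Precedes x u k i ∨ Precedes x u i k := by
  unfold Precedes
  rcases lt_trichotomy |x k - u| |x i - u| with h1 | h1 | h1
  · exact Or.inl (Or.inl h1)
  · rcases lt_or_gt_of_ne h with h2 | h2
    · exact Or.inl (Or.inr ⟨h1, h2⟩)
    · exact Or.inr (Or.inr ⟨h1.symm, h2⟩)
  · exact Or.inr (Or.inl h1)

open Classical in
/-- A stable matching of agents to facilities with capacities `c`: no agent who strictly prefers
facility `j` to its own assignment would be accommodated there. -/
structure IsStable {n m : ℕ} (c : Fin m → ℕ) (x : Fin n → ℝ) (y : Fin m → ℝ)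
    (f : Fin n → Option (Fin m)) : Prop where
  card_le : ∀ j, (Finset.univ.filter fun i => f i = some j).card ≤ c j
  stable : ∀ i j, (∃ j', f i = some j' ∧ |x i - y j'| ≤ |x i - y j|) ∨
    c j ≤ (Finset.univ.filter fun k => f k = some j ∧ Precedes x (y j) k i).card

/-- The total utility of the agents under a matching. -/
noncomputable def matchingWelfare {n m : ℕ} (x : Fin n → ℝ) (y : Fin m → ℝ)
    (f : Fin n → Option (Fin m)) : ℝ :=
  ∑ i, (f i).elim 0 fun j => 1 - |x i - y j|

open Classical in
/-- Greedy construction of a stable matching on a set of agents. -/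
theorem exists_isStable_on {n m : ℕ} (x : Fin n → ℝ) (y : Fin m → ℝ) (U : Finset (Fin n)) :
    ∀ c : Fin m → ℕ, ∃ f : Fin n → Option (Fin m), (∀ i ∉ U, f i = none) ∧
      (∀ j, (Finset.univ.filter fun i => f i = some j).card ≤ c j) ∧
      ∀ i ∈ U, ∀ j, (∃ j', f i = some j' ∧ |x i - y j'| ≤ |x i - y j|) ∨
        c j ≤ (Finset.univ.filter fun k => f k = some j ∧ Precedes x (y j) k i).card := by
  induction hN : U.card generalizing U with
  | zero =>
    intro c
    rw [Finset.card_eq_zero] at hN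
    subst hN
    exact ⟨fun _ => none, by simp, by simp, by simp⟩
  | succ N ih =>
    intro c
    by_cases hc : ∀ j, c j = 0
    · exact ⟨fun _ => none, by simp, by simp, fun i _ j => Or.inr (by simp [hc j])⟩
    push Not at hc
    obtain ⟨j₁, hj₁⟩ := hc
    have hU : U.Nonempty := by
      rw [← Finset.card_pos]; omega
    -- A shortest pair among remaining agents and facilities with room, ties broken by index as in
    -- the queue. `i₀` has no closer facility with room and precedes all remaining agents at `j₀`,
    -- so this pair can be fixed for good.
    obtain ⟨⟨i₀, j₀⟩, hmem, hmin⟩ := Finset.exists_min_image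
      (U ×ˢ (Finset.univ.filter fun j => c j ≠ 0))
      (fun a => toLex (|x a.1 - y a.2|, a.1))
      (by obtain ⟨i, hi⟩ := hU; exact ⟨(i, j₁), by simp [hi, hj₁]⟩)
    simp only [Finset.mem_product, Finset.mem_filter, Finset.mem_univ, true_and] at hmem hmin
    obtain ⟨hi₀, hj₀⟩ := hmem
    obtain ⟨f, hf1, hf2, hf3⟩ := ih (U.erase i₀)
      (by rw [Finset.card_erase_of_mem hi₀, hN]; rfl) (Function.update c j₀ (c j₀ - 1))
    have hfi₀ : f i₀ = none := hf1 i₀ (by simp)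
    have hprec : ∀ i ∈ U, i ≠ i₀ → Precedes x (y j₀) i₀ i := by
      intro i hi hne
      have h := hmin (i, j₀) ⟨hi, hj₀⟩
      rw [Prod.Lex.toLex_le_toLex] at h
      rcases h with h | ⟨h, h'⟩
      · exact Or.inl h
      · exact Or.inr ⟨h, lt_of_le_of_ne h' (Ne.symm hne)⟩
    refine ⟨Function.update f i₀ (some j₀), ?_, ?_, ?_⟩
    · intro i hi
      have hne : i ≠ i₀ := by rintro rfl; exact hi hi₀
      rw [Function.update_of_ne hne]
      exact hf1 i (by simp [hi])
    · intro j
      by_cases hj : j = j₀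
      · subst hj
        have h := hf2 j
        rw [Function.update_self] at h
        have hsub : (Finset.univ.filter fun i => Function.update f i₀ (some j) i = some j) ⊆
            insert i₀ (Finset.univ.filter fun i => f i = some j) := by
          intro i hi
          by_cases hne : i = i₀
          · simp [hne]
          · simp only [Finset.mem_filter, Finset.mem_univ, true_and,
              Function.update_of_ne hne] at hi
            simp [hi]
        have := (Finset.card_le_card hsub).trans (Finset.card_insert_le _ _)
        omega
      · have h := hf2 j
        rw [Function.update_of_ne hj] at h
        refine le_trans (Finset.card_le_card ?_) h
        intro i hi
        by_cases hne : i = i₀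
        · subst hne
          simp only [Finset.mem_filter, Finset.mem_univ, true_and, Function.update_self,
            Option.some.injEq] at hi
          exact absurd hi.symm hj
        · simpa [Function.update_of_ne hne] using hi
    · intro i hi j
      by_cases hne : i = i₀
      · subst hne
        by_cases hcj : c j = 0
        · exact Or.inr (by simp [hcj])
        · left
          refine ⟨j₀, Function.update_self .., ?_⟩
          have h := hmin (i, j) ⟨hi, hcj⟩
          rw [Prod.Lex.toLex_le_toLex] at h
          rcases h with h | ⟨h, -⟩
          · exact h.le
          · exact h.le
      · rcases hf3 i (by simp [hi, hne]) j with ⟨j', h1, h2⟩ | h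
        · exact Or.inl ⟨j', by rw [Function.update_of_ne hne, h1], h2⟩
        · right
          by_cases hj : j = j₀
          · subst hj
            rw [Function.update_self] at h
            have hsub : insert i₀ (Finset.univ.filter fun k => f k = some j ∧
                Precedes x (y j) k i) ⊆ Finset.univ.filter fun k =>
                  Function.update f i₀ (some j) k = some j ∧ Precedes x (y j) k i := by
              intro k hk
              by_cases hk0 : k = i₀
              · subst hk0
                simp [hprec i hi hne]
              · simpa [hk0, Function.update_of_ne hk0] using hk
            have h2 := Finset.card_le_card hsub
            rw [Finset.card_insert_of_notMem (by simp [hfi₀])] at h2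
            omega
          · rw [Function.update_of_ne hj] at h
            refine h.trans (Finset.card_le_card ?_)
            intro k hk
            have hk0 : k ≠ i₀ := by
              rintro rfl
              simp [hfi₀] at hk
            simpa [Function.update_of_ne hk0] using hk

theorem exists_isStable {n m : ℕ} (c : Fin m → ℕ) (x : Fin n → ℝ) (y : Fin m → ℝ) :
    ∃ f, IsStable c x y f := by
  classical
  obtain ⟨f, -, h1, h2⟩ := exists_isStable_on x y Finset.univ c
  refine ⟨f, ⟨fun j => ?_, fun i j => ?_⟩⟩
  · convert h1 j
  · convert h2 i (Finset.mem_univ i) j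

open Classical in
/-- If agent `k` strictly prefers facility `j` to its assignment, then `j` is full. -/
theorem IsStable.card_eq_of_prefers {n m : ℕ} {c : Fin m → ℕ} {x : Fin n → ℝ} {y : Fin m → ℝ}
    {f : Fin n → Option (Fin m)} (hf : IsStable c x y f) {k : Fin n} {j : Fin m}
    (hk : ∀ j', f k = some j' → |x k - y j| < |x k - y j'|) :
    (Finset.univ.filter fun l => f l = some j).card = c j := by
  refine le_antisymm (hf.card_le j) ?_
  rcases hf.stable k j with ⟨j', h, h'⟩ | h
  · exact absurd h' (not_le.mpr (hk j' h))
  · refine h.trans (Finset.card_le_card fun l hl => ?_)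
    simp only [Finset.mem_filter, Finset.mem_univ, true_and] at hl ⊢
    exact hl.1

open Classical in
/-- If agent `k` strictly prefers facility `j` to its assignment, then all the agents assigned to
`j` come before `k` there. -/
theorem IsStable.precedes_of_prefers {n m : ℕ} {c : Fin m → ℕ} {x : Fin n → ℝ} {y : Fin m → ℝ}
    {f : Fin n → Option (Fin m)} (hf : IsStable c x y f) {i k : Fin n} {j : Fin m}
    (hi : f i = some j) (hk : ∀ j', f k = some j' → |x k - y j| < |x k - y j'|) :
    Precedes x (y j) i k := by
  rcases hf.stable k j with ⟨j', h, h'⟩ | h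
  · exact absurd h' (not_le.mpr (hk j' h))
  · have hsub : (Finset.univ.filter fun l => f l = some j ∧ Precedes x (y j) l k) ⊆
        Finset.univ.filter fun l => f l = some j := by
      intro l hl
      simp only [Finset.mem_filter, Finset.mem_univ, true_and] at hl ⊢
      exact hl.1
    have heq := Finset.eq_of_subset_of_card_le hsub ((hf.card_le j).trans h)
    have : i ∈ Finset.univ.filter fun l => f l = some j := by simp [hi]
    rw [← heq] at this
    simp only [Finset.mem_filter, Finset.mem_univ, true_and] at this
    exact this.2

theorem IsStable.precedes_of_eq_none {n m : ℕ} {c : Fin m → ℕ} {x : Fin n → ℝ} {y : Fin m → ℝ}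
    {f : Fin n → Option (Fin m)} (hf : IsStable c x y f) {i k : Fin n} {j : Fin m}
    (hi : f i = some j) (hk : f k = none) : Precedes x (y j) i k :=
  hf.precedes_of_prefers hi fun j' h => by simp [hk] at h

open Classical in
theorem queuePosition_eq {n m : ℕ} (x : Fin n → ℝ) (y : Fin m → ℝ) (s : Fin n → Fin m)
    (i : Fin n) : queuePosition x y s i =
      (Finset.univ.filter fun k => s k = s i ∧ Precedes x (y (s i)) k i).card := by
  unfold queuePosition Precedes
  congr

/-- Every stable matching is realized by a Nash equilibrium. -/
theorem IsStable.exists_nash {n m : ℕ} {q : Fin (m + 1) → ℝ} {x : Fin n → ℝ}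
    {y : Fin (m + 1) → ℝ} {f : Fin n → Option (Fin (m + 1))}
    (hf : IsStable (capacity q n) x y f) (hd : ∀ i j, |x i - y j| ≤ 1) :
    ∃ s, IsNashEquilibrium q x y s ∧ socialWelfare q x y s = matchingWelfare x y f := by
  classical
  -- Unmatched agents may select any facility, here 0: matched agents preceding them fill every
  -- facility, so they get utility 0 and displace nobody.
  set s : Fin n → Fin (m + 1) := fun i => (f i).getD 0 with hs
  have hsome : ∀ i j, f i = some j → s i = j := by
    intro i j h
    simp [hs, h]
  have hserved : ∀ i j, f i = some j → queuePosition x y s i < capacity q n j := by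
    intro i j h
    rw [queuePosition_eq, hsome i j h]
    refine lt_of_lt_of_le (Finset.card_lt_card ?_) (hf.card_le j)
    rw [Finset.ssubset_iff_of_subset]
    · exact ⟨i, by simp [h], by
        simp only [Finset.mem_filter, Finset.mem_univ, true_and, not_and]
        exact fun _ h' => h'.ne rfl⟩
    · intro k hk
      simp only [Finset.mem_filter, Finset.mem_univ, true_and] at hk ⊢
      cases hfk : f k with
      | none => exact absurd hk.2 (hf.precedes_of_eq_none h hfk).asymm
      | some j' => rw [← hsome k j' hfk, hk.1]
  have hutil : ∀ i, utility q x y s i = (f i).elim 0 fun j => 1 - |x i - y j| := by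
    intro i
    unfold utility
    cases hfi : f i with
    | some j =>
      have h := hserved i j hfi
      rw [hsome i j hfi, if_pos h]
      rfl
    | none =>
      rw [if_neg]
      · rfl
      · rw [not_lt, queuePosition_eq]
        rcases hf.stable i (s i) with ⟨j', h, -⟩ | h
        · simp [hfi] at h
        · refine h.trans (Finset.card_le_card ?_)
          intro k hk
          simp only [Finset.mem_filter, Finset.mem_univ, true_and] at hk ⊢
          exact ⟨hsome k _ hk.1, hk.2⟩
  have hnonneg : ∀ i, 0 ≤ utility q x y s i := by
    intro i
    rw [hutil]
    cases f i with
    | none => exact le_rfl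
    | some j => simpa using hd i j
  refine ⟨s, fun i j => ?_, Finset.sum_congr rfl fun i _ => hutil i⟩
  have hle : utility q x y (Function.update s i j) i ≤ 1 - |x i - y j| := by
    unfold utility
    rw [Function.update_self]
    split_ifs
    · exact le_rfl
    · simpa using hd i j
  rcases hf.stable i j with ⟨j', h1, h2⟩ | h
  · refine hle.trans ?_
    rw [hutil, h1]
    exact sub_le_sub_left h2 1
  · have h0 : utility q x y (Function.update s i j) i = 0 := by
      unfold utility
      rw [if_neg]
      rw [not_lt, queuePosition_eq, Function.update_self]
      refine h.trans (Finset.card_le_card ?_)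
      intro k hk
      simp only [Finset.mem_filter, Finset.mem_univ, true_and] at hk ⊢
      rw [Function.update_of_ne hk.2.ne]
      exact ⟨hsome k _ hk.1, hk.2⟩
    rw [h0]
    exact hnonneg i

/-! ### The agents closest to a point -/

/-- `T` consists of the first agents in the queue of a facility placed at `u`. -/
def IsClosestSet {n : ℕ} (x : Fin n → ℝ) (u : ℝ) (T : Finset (Fin n)) : Prop :=
  ∀ i ∈ T, ∀ k ∉ T, Precedes x u i k

/-- Take the agents matched by a stable matching with a single facility of capacity `c` at `u`. -/
theorem exists_isClosestSet {n : ℕ} (x : Fin n → ℝ) (u : ℝ) {c : ℕ} (hc : c ≤ n) :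
    ∃ T : Finset (Fin n), T.card = c ∧ IsClosestSet x u T := by
  classical
  obtain ⟨f, hf⟩ := exists_isStable (m := 1) (fun _ => c) x fun _ => u
  have hone : ∀ i j, f i = some j → f i = some 0 := by
    intro i j h
    rw [h, Subsingleton.elim j 0]
  have hnot : ∀ i, ¬ f i = some 0 → f i = none := by
    intro i hi
    cases h : f i with
    | none => rfl
    | some j => exact absurd (hone i j h) hi
  refine ⟨Finset.univ.filter fun i => f i = some 0, le_antisymm (by convert hf.card_le 0) ?_, ?_⟩
  · by_contra! hlt
    obtain ⟨k, hk⟩ : ∃ k, ¬ f k = some 0 := by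
      by_contra! hall
      have : (Finset.univ.filter fun i => f i = some 0) = Finset.univ := by
        ext i; simp [hall i]
      rw [this, Finset.card_univ, Fintype.card_fin] at hlt
      omega
    rcases hf.stable k 0 with ⟨j', h, -⟩ | h
    · exact hk (hone k j' h)
    · refine absurd (h.trans (Finset.card_le_card ?_)) (not_le.mpr hlt)
      intro l hl
      simp only [Finset.mem_filter, Finset.mem_univ, true_and] at hl ⊢
      exact hl.1
  · intro i hi k hk
    simp only [Finset.mem_filter, Finset.mem_univ, true_and] at hi hk
    exact hf.precedes_of_eq_none hi (hnot k hk)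

/-- Exchange argument: a set of dominating weights. -/
theorem sum_le_sum_of_dominates {ι : Type*} (S T : Finset ι) (v w : ι → ℝ)
    (hcard : S.card ≤ T.card) (hw : ∀ i ∈ T, 0 ≤ w i)
    (hST : ∀ i ∈ S, ∀ k ∈ T, v i ≤ w k) : ∑ i ∈ S, v i ≤ ∑ i ∈ T, w i := by
  rcases T.eq_empty_or_nonempty with rfl | hT
  · have : S = ∅ := by simpa using hcard
    simp [this]
  obtain ⟨k, hk, hmin⟩ := Finset.exists_min_image T w hT
  calc ∑ i ∈ S, v i ≤ S.card • w k := Finset.sum_le_card_nsmul _ _ _ fun i hi => hST i hi k hk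
    _ ≤ T.card • w k := by
        simp only [nsmul_eq_mul]
        exact mul_le_mul_of_nonneg_right (by exact_mod_cast hcard) (hw k hk)
    _ ≤ ∑ i ∈ T, w i := Finset.card_nsmul_le_sum _ _ _ hmin

/-- The common agents cancel, and each agent of `T \ S` is at least as close to `u` as each agent of
`S \ T`. -/
theorem IsClosestSet.sum_le {n : ℕ} {x : Fin n → ℝ} {u : ℝ} {S T : Finset (Fin n)}
    (hT : IsClosestSet x u T) (hcard : S.card ≤ T.card) (hd : ∀ i, |x i - u| ≤ 1) :
    ∑ i ∈ S, (1 - |x i - u|) ≤ ∑ i ∈ T, (1 - |x i - u|) := by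
  classical
  rw [← Finset.sum_inter_add_sum_sdiff S T, ← Finset.sum_inter_add_sum_sdiff T S,
    Finset.inter_comm T S]
  gcongr 1
  refine sum_le_sum_of_dominates _ _ _ _ ?_ (fun i _ => by linarith [hd i]) ?_
  · have h1 := Finset.card_sdiff_add_card_inter S T
    have h2 := Finset.card_sdiff_add_card_inter T S
    rw [Finset.inter_comm] at h2
    omega
  · intro i hi k hk
    simp only [Finset.mem_sdiff] at hi hk
    linarith [(hT k hk.1 i hi.2).dist_le]

/-! ### Accommodated agents -/

/-- The agents accommodated by facility `j`. -/
noncomputable def servedAt {n m : ℕ} (q : Fin m → ℝ) (x : Fin n → ℝ) (y : Fin m → ℝ)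
    (s : Fin n → Fin m) (j : Fin m) : Finset (Fin n) :=
  Finset.univ.filter fun i => s i = j ∧ queuePosition x y s i < capacity q n j

/-- Queue positions at one facility are pairwise distinct, and those of accommodated agents lie
below the capacity. -/
theorem card_servedAt_le {n m : ℕ} (q : Fin m → ℝ) (x : Fin n → ℝ) (y : Fin m → ℝ)
    (s : Fin n → Fin m) (j : Fin m) : (servedAt q x y s j).card ≤ capacity q n j := by
  classical
  have hlt : ∀ i k, s i = j → s k = j → Precedes x (y j) i k →
      queuePosition x y s i < queuePosition x y s k := by
    intro i k hi hk h
    rw [queuePosition_eq, queuePosition_eq, hi, hk]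
    refine Finset.card_lt_card ?_
    rw [Finset.ssubset_iff_of_subset]
    · exact ⟨i, by simp [hi, h], by
        simp only [Finset.mem_filter, Finset.mem_univ, true_and, not_and]
        exact fun _ h' => h'.ne rfl⟩
    · intro l hl
      simp only [Finset.mem_filter, Finset.mem_univ, true_and] at hl ⊢
      exact ⟨hl.1, hl.2.trans h⟩
  rw [← Finset.card_range (capacity q n j)]
  refine Finset.card_le_card_of_injOn (queuePosition x y s) ?_ ?_
  · intro i hi
    simp only [servedAt, Finset.coe_filter, Finset.mem_univ, true_and, Set.mem_ofPred_eq] at hi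
    simpa using hi.2
  · intro i hi k hk h
    simp only [servedAt, Finset.coe_filter, Finset.mem_univ, true_and, Set.mem_ofPred_eq] at hi hk
    by_contra hne
    rcases precedes_or_precedes x (y j) hne with h' | h'
    · exact (hlt i k hi.1 hk.1 h').ne h
    · exact (hlt k i hk.1 hi.1 h').ne h.symm

theorem socialWelfare_eq_sum_servedAt {n m : ℕ} (q : Fin m → ℝ) (x : Fin n → ℝ) (y : Fin m → ℝ)
    (s : Fin n → Fin m) :
    socialWelfare q x y s = ∑ j, ∑ i ∈ servedAt q x y s j, (1 - |x i - y j|) := by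
  unfold socialWelfare
  rw [← Finset.sum_fiberwise Finset.univ s]
  refine Finset.sum_congr rfl fun j _ => ?_
  have : servedAt q x y s j = (Finset.univ.filter fun i => s i = j).filter
      fun i => queuePosition x y s i < capacity q n j := by
    unfold servedAt
    rw [Finset.filter_filter]
  rw [this, Finset.sum_filter (fun i => queuePosition x y s i < capacity q n j)]
  refine Finset.sum_congr rfl fun i hi => ?_
  simp only [Finset.mem_filter, Finset.mem_univ, true_and] at hi
  subst hi
  rfl

/-! ### Lower bounds for the optimal welfare -/

theorem socialWelfare_le {n m : ℕ} (q : Fin m → ℝ) (x : Fin n → ℝ) (y : Fin m → ℝ)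
    (s : Fin n → Fin m) : socialWelfare q x y s ≤ n := by
  unfold socialWelfare
  have : ∀ i ∈ Finset.univ, utility q x y s i ≤ 1 := by
    intro i _
    unfold utility
    split_ifs
    · linarith [abs_nonneg (x i - y (s i))]
    · exact zero_le_one
  simpa using Finset.sum_le_card_nsmul _ _ _ this

theorem socialWelfare_le_optimalWelfare {n m : ℕ} {q : Fin m → ℝ} {x : Fin n → ℝ}
    {y : Fin m → ℝ} {s : Fin n → Fin m} (hy : ∀ j, y j ∈ Set.Icc (0 : ℝ) 1)
    (hs : IsNashEquilibrium q x y s) : socialWelfare q x y s ≤ optimalWelfare q x := by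
  refine le_csSup ⟨n, ?_⟩ ⟨y, hy, s, hs, rfl⟩
  rintro w ⟨y, -, s, -, rfl⟩
  exact socialWelfare_le q x y s

theorem abs_sub_le_one_of_mem_Icc {a b : ℝ} (ha : a ∈ Set.Icc (0 : ℝ) 1)
    (hb : b ∈ Set.Icc (0 : ℝ) 1) : |a - b| ≤ 1 := by
  rw [abs_le]
  constructor <;> linarith [ha.1, ha.2, hb.1, hb.2]

/-- The optimum ranges over all equilibria, so one stable matching at one placement bounds it from
below. Every improvement enters through this bound. -/
theorem IsStable.matchingWelfare_le {n m : ℕ} {q : Fin (m + 1) → ℝ} {x : Fin n → ℝ}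
    {y : Fin (m + 1) → ℝ} {f : Fin n → Option (Fin (m + 1))}
    (hf : IsStable (capacity q n) x y f) (hx : ∀ i, x i ∈ Set.Icc (0 : ℝ) 1)
    (hy : ∀ j, y j ∈ Set.Icc (0 : ℝ) 1) : matchingWelfare x y f ≤ optimalWelfare q x := by
  obtain ⟨s, hs, h⟩ := hf.exists_nash fun i j => abs_sub_le_one_of_mem_Icc (hx i) (hy j)
  exact h ▸ socialWelfare_le_optimalWelfare hy hs

theorem exists_isNashEquilibrium {n m : ℕ} (q : Fin (m + 1) → ℝ) {x : Fin n → ℝ}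
    {y : Fin (m + 1) → ℝ} (hx : ∀ i, x i ∈ Set.Icc (0 : ℝ) 1)
    (hy : ∀ j, y j ∈ Set.Icc (0 : ℝ) 1) : ∃ s, IsNashEquilibrium q x y s := by
  obtain ⟨f, hf⟩ := exists_isStable (capacity q n) x y
  obtain ⟨s, hs, -⟩ := hf.exists_nash fun i j => abs_sub_le_one_of_mem_Icc (hx i) (hy j)
  exact ⟨s, hs⟩

/-- The welfare of a profile is at most the welfare obtained when each facility accommodates its
closest agents. -/
theorem socialWelfare_le_sum_isClosestSet {n m : ℕ} {q : Fin m → ℝ} {x : Fin n → ℝ}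
    {y : Fin m → ℝ} (s : Fin n → Fin m) {T : Fin m → Finset (Fin n)}
    (hT : ∀ j, IsClosestSet x (y j) (T j)) (hcard : ∀ j, (T j).card = capacity q n j)
    (hd : ∀ i j, |x i - y j| ≤ 1) :
    socialWelfare q x y s ≤ ∑ j, ∑ i ∈ T j, (1 - |x i - y j|) := by
  rw [socialWelfare_eq_sum_servedAt]
  exact Finset.sum_le_sum fun j _ => (hT j).sum_le
    ((card_servedAt_le q x y s j).trans (hcard j).ge) fun i => hd i j

/-- The welfare when all the facilities are at the same place. -/
theorem socialWelfare_const_le {n m : ℕ} {q : Fin m → ℝ} {x : Fin n → ℝ} {u : ℝ}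
    {y : Fin m → ℝ} (hy : ∀ j, y j = u) (s : Fin n → Fin m) {T : Finset (Fin n)}
    (hT : IsClosestSet x u T) (hcard : T.card = ∑ j, capacity q n j)
    (hd : ∀ i, |x i - u| ≤ 1) :
    socialWelfare q x y s ≤ ∑ i ∈ T, (1 - |x i - u|) := by
  classical
  have hdisj : ∀ i ∈ Finset.univ, ∀ j ∈ Finset.univ, i ≠ j →
      Disjoint (servedAt q x y s i) (servedAt q x y s j) := by
    intro j _ j' _ hne
    rw [Finset.disjoint_left]
    intro i hi hi'
    simp only [servedAt, Finset.mem_filter, Finset.mem_univ, true_and] at hi hi'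
    exact hne (hi.1.symm.trans hi'.1)
  rw [socialWelfare_eq_sum_servedAt]
  simp only [hy]
  rw [← Finset.sum_biUnion fun i hi j hj => hdisj i hi j hj]
  refine hT.sum_le ?_ hd
  rw [Finset.card_biUnion hdisj, hcard]
  exact Finset.sum_le_sum fun j _ => card_servedAt_le q x y s j

theorem matchingWelfare_eq_sum {n m : ℕ} (x : Fin n → ℝ) (y : Fin m → ℝ)
    (f : Fin n → Option (Fin m)) :
    matchingWelfare x y f = ∑ j, ∑ i with f i = some j, (1 - |x i - y j|) := by
  unfold matchingWelfare
  simp only [Finset.sum_filter]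
  rw [Finset.sum_comm]
  refine Finset.sum_congr rfl fun i _ => ?_
  cases f i with
  | none => simp
  | some j => simp

/-- Disjoint sets of closest agents form a stable matching. -/
theorem exists_isStable_of_disjoint {n m : ℕ} {c : Fin m → ℕ} {x : Fin n → ℝ} {y : Fin m → ℝ}
    {T : Fin m → Finset (Fin n)} (hT : ∀ j, IsClosestSet x (y j) (T j))
    (hcard : ∀ j, (T j).card = c j) (hdisj : ∀ j j', j ≠ j' → Disjoint (T j) (T j')) :
    ∃ f, IsStable c x y f ∧ matchingWelfare x y f = ∑ j, ∑ i ∈ T j, (1 - |x i - y j|) := by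
  classical
  set f : Fin n → Option (Fin m) := fun i =>
    if h : ∃ j, i ∈ T j then some h.choose else none with hfdef
  have hf : ∀ i j, f i = some j ↔ i ∈ T j := by
    intro i j
    constructor
    · intro h
      by_cases hex : ∃ j, i ∈ T j
      · simp only [hfdef, dif_pos hex, Option.some.injEq] at h
        exact h ▸ hex.choose_spec
      · simp [hfdef, dif_neg hex] at h
    · intro h
      have hex : ∃ j, i ∈ T j := ⟨j, h⟩
      simp only [hfdef, dif_pos hex, Option.some.injEq]
      by_contra hne
      exact Finset.disjoint_left.mp (hdisj _ _ hne) hex.choose_spec h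
  have hfil : ∀ j, (Finset.univ.filter fun i => f i = some j) = T j := by
    intro j
    ext i
    simp [hf]
  refine ⟨f, ⟨fun j => ?_, fun i j => ?_⟩, ?_⟩
  · rw [← hcard j, ← hfil j]
  · by_cases hi : i ∈ T j
    · exact Or.inl ⟨j, (hf i j).mpr hi, le_rfl⟩
    · right
      rw [← hcard j]
      refine Finset.card_le_card fun k hk => ?_
      simp only [Finset.mem_filter, Finset.mem_univ, true_and]
      exact ⟨(hf k j).mpr hk, hT j k hk i hi⟩
  · rw [matchingWelfare_eq_sum]
    simp only [hfil]

/-! ### Change of welfare under small displacements of the facilities. -/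

open Classical in
theorem sum_add_gain_eq {ι : Type*} (w : ι → ℝ) (δ : ℝ) {G T : Finset ι} (hGT : G ⊆ T) :
    ∑ i ∈ T, w i + δ * (2 * G.card - T.card) = ∑ i ∈ T, (w i + if i ∈ G then δ else -δ) := by
  rw [Finset.sum_add_distrib]
  congr 1
  rw [Finset.sum_ite, Finset.filter_mem_eq_inter, Finset.inter_eq_right.mpr hGT,
    Finset.filter_notMem_eq_sdiff, Finset.sum_const, Finset.sum_const,
    Finset.card_sdiff_of_subset hGT, nsmul_eq_mul, nsmul_eq_mul,
    Nat.cast_sub (Finset.card_le_card hGT)]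
  ring

/-- The effect of moving a facility by at most `δ` when the agents in `G` gain `δ`. -/
theorem sum_add_le_sum_of_gain {n : ℕ} {x : Fin n → ℝ} {u u' δ : ℝ} {G T : Finset (Fin n)}
    (hu : |u' - u| ≤ δ) (hGT : G ⊆ T) (hG : ∀ i ∈ G, |x i - u'| ≤ |x i - u| - δ) :
    ∑ i ∈ T, (1 - |x i - u|) + δ * (2 * G.card - T.card) ≤ ∑ i ∈ T, (1 - |x i - u'|) := by
  classical
  rw [sum_add_gain_eq _ _ hGT]
  refine Finset.sum_le_sum fun i _ => ?_
  split_ifs with hi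
  · linarith [hG i hi]
  · have := abs_sub_le (x i) u u'
    rw [abs_sub_comm u u'] at this
    linarith

open Classical in
/-- The agents accommodated under a matching. -/
noncomputable def matched {n m : ℕ} (f : Fin n → Option (Fin m)) : Finset (Fin n) :=
  Finset.univ.filter fun i => f i ≠ none

theorem mem_matched {n m : ℕ} {f : Fin n → Option (Fin m)} {i : Fin n} :
    i ∈ matched f ↔ ∃ j, f i = some j := by
  simp [matched, Option.ne_none_iff_exists']

open Classical in
theorem card_matched {n m : ℕ} (f : Fin n → Option (Fin m)) :
    (matched f).card = ∑ j, (Finset.univ.filter fun i => f i = some j).card := by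
  rw [← Finset.card_biUnion]
  · congr 1
    ext i
    simp [mem_matched]
  · intro j _ j' _ hne
    rw [Function.onFun, Finset.disjoint_left]
    intro i hi hi'
    simp only [Finset.mem_filter, Finset.mem_univ, true_and] at hi hi'
    exact hne (Option.some.inj (hi.symm.trans hi'))

/-- If some agent of `T` is unmatched, it prefers every facility to its assignment, so stability
forces all of them to be full. -/
theorem IsStable.card_le_card_matched {n m : ℕ} {c : Fin m → ℕ} {x : Fin n → ℝ} {y : Fin m → ℝ}
    {f : Fin n → Option (Fin m)} (hf : IsStable c x y f) {T : Finset (Fin n)}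
    (hcard : T.card = ∑ j, c j) : T.card ≤ (matched f).card := by
  classical
  by_cases h : T ⊆ matched f
  · exact Finset.card_le_card h
  · obtain ⟨k, -, hk⟩ := Finset.not_subset.mp h
    have hk : f k = none := by
      by_contra hne
      exact hk (mem_matched.mpr (Option.ne_none_iff_exists'.mp hne))
    rw [hcard, card_matched]
    refine Finset.sum_le_sum fun j _ => (hf.card_eq_of_prefers (k := k) ?_).ge
    intro j' h
    simp [hk] at h

theorem IsStable.card_matched_le {n m : ℕ} {c : Fin m → ℕ} {x : Fin n → ℝ} {y : Fin m → ℝ}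
    {f : Fin n → Option (Fin m)} (hf : IsStable c x y f) : (matched f).card ≤ ∑ j, c j := by
  classical
  rw [card_matched]
  exact Finset.sum_le_sum fun j _ => hf.card_le j

/-- Every stable matching for facilities within `δ` of `u` does almost as well as the closest
agents to `u`, and better if many agents gain `δ`. -/
theorem IsStable.sum_add_le_matchingWelfare {n m : ℕ} {c : Fin m → ℕ} {x : Fin n → ℝ}
    {y : Fin m → ℝ} {f : Fin n → Option (Fin m)} (hf : IsStable c x y f) {u δ : ℝ}
    {G T : Finset (Fin n)} (hd : ∀ i j, |x i - y j| ≤ 1) (hcard : T.card = ∑ j, c j)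
    (hy : ∀ j, |y j - u| ≤ δ) (hGT : G ⊆ T)
    (hG : ∀ i ∈ G, ∃ j, f i = some j ∧ |x i - y j| ≤ |x i - u| - δ) :
    ∑ i ∈ T, (1 - |x i - u|) + δ * (2 * G.card - T.card) ≤ matchingWelfare x y f := by
  classical
  have hdist : ∀ i j, |x i - y j| ≤ |x i - u| + δ := by
    intro i j
    have := abs_sub_le (x i) u (y j)
    rw [abs_sub_comm u (y j)] at this
    linarith [hy j]
  set v : Fin n → ℝ := fun i => (f i).elim 0 fun j => 1 - |x i - y j| with hv
  have hvs : ∀ i j, f i = some j → v i = 1 - |x i - y j| := by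
    intro i j h
    simp [hv, h]
  have h2 : matchingWelfare x y f = ∑ i ∈ matched f, v i := by
    unfold matchingWelfare
    refine (Finset.sum_subset (Finset.subset_univ _) fun i _ hi => ?_).symm
    have : f i = none := by
      by_contra hne
      exact hi (mem_matched.mpr (Option.ne_none_iff_exists'.mp hne))
    simp [this]
  -- Matched agents of `T` are compared one by one. Unmatched agents of `T` lie outside `G` and are
  -- replaced by at least as many matched agents outside `T`. A replacement `i` at `y j` precedes
  -- the unmatched `k` there, so |x i - y j| ≤ |x k - y j| ≤ |x k - u| + δ.
  rw [sum_add_gain_eq _ _ hGT, h2, ← Finset.sum_inter_add_sum_sdiff (matched f) T,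
    ← Finset.sum_inter_add_sum_sdiff T (matched f), Finset.inter_comm T]
  refine add_le_add (Finset.sum_le_sum fun i hi => ?_) ?_
  · obtain ⟨j, hj⟩ := mem_matched.mp (Finset.mem_inter.mp hi).1
    rw [hvs i j hj]
    split_ifs with hiG
    · obtain ⟨j', hj', h⟩ := hG i hiG
      obtain rfl : j' = j := Option.some.inj (hj'.symm.trans hj)
      linarith
    · linarith [hdist i j]
  · refine sum_le_sum_of_dominates _ _ _ _ ?_ ?_ ?_
    · have h3 := hf.card_le_card_matched hcard
      have h4 := Finset.card_sdiff_add_card_inter (matched f) T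
      have h5 := Finset.card_sdiff_add_card_inter T (matched f)
      rw [Finset.inter_comm] at h5
      omega
    · intro i hi
      obtain ⟨j, hj⟩ := mem_matched.mp (Finset.mem_sdiff.mp hi).1
      rw [hvs i j hj]
      linarith [hd i j]
    · intro k hk i hi
      rw [Finset.mem_sdiff] at hk hi
      obtain ⟨j, hj⟩ := mem_matched.mp hi.1
      have hkG : k ∉ G := by
        intro hkG
        obtain ⟨j', hj', -⟩ := hG k hkG
        exact hk.2 (mem_matched.mpr ⟨j', hj'⟩)
      have hkn : f k = none := by
        by_contra hne
        exact hk.2 (mem_matched.mpr (Option.ne_none_iff_exists'.mp hne))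
      rw [hvs i j hj, if_neg hkG]
      linarith [(hf.precedes_of_eq_none hj hkn).dist_le, hdist k j]

/-- Every closed interval of length `2 * δ` contains at most `K` agents. -/
def IsSpread {n : ℕ} (x : Fin n → ℝ) (δ K : ℝ) : Prop :=
  ∀ A : Finset (Fin n), (∃ t, ∀ i ∈ A, x i ∈ Set.Icc t (t + 2 * δ)) → (A.card : ℝ) ≤ K

/-- Both differences have the same size because `T` and the matched set do. If `k` in `T` is
unmatched, every matched agent outside `T` is at distance between |x k - u| and |x k - u| + 2δ from
`u`: closer than `k` to some facility near `u`, but not to `u` itself. This leaves two windows of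
length 2δ, one on each side. -/
theorem IsStable.card_sdiff_le {n m : ℕ} {c : Fin m → ℕ} {x : Fin n → ℝ}
    {y : Fin m → ℝ} {f : Fin n → Option (Fin m)} (hf : IsStable c x y f) {u δ K : ℝ}
    {T : Finset (Fin n)} (hcard : T.card = ∑ j, c j) (hT : IsClosestSet x u T)
    (hy : ∀ j, |y j - u| ≤ δ) (hx : IsSpread x δ K) :
    ((T \ matched f).card : ℝ) ≤ 2 * K ∧ ((matched f \ T).card : ℝ) ≤ 2 * K := by
  classical
  have hle := hf.card_matched_le
  have hge := hf.card_le_card_matched hcard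
  have h4 := Finset.card_sdiff_add_card_inter (matched f) T
  have h5 := Finset.card_sdiff_add_card_inter T (matched f)
  rw [Finset.inter_comm] at h5
  have heq : (T \ matched f).card = (matched f \ T).card := by omega
  rw [heq, and_self]
  rcases (T \ matched f).eq_empty_or_nonempty with he | ⟨k, hk⟩
  · rw [← heq, he]
    have := hx ∅ ⟨0, by simp⟩
    simp only [Finset.card_empty, Nat.cast_zero] at this ⊢
    linarith
  rw [Finset.mem_sdiff] at hk
  have hkn : f k = none := by
    by_contra hne
    exact hk.2 (mem_matched.mpr (Option.ne_none_iff_exists'.mp hne))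
  have key : ∀ i ∈ matched f \ T, |x k - u| ≤ |x i - u| ∧ |x i - u| ≤ |x k - u| + 2 * δ := by
    intro i hi
    rw [Finset.mem_sdiff] at hi
    obtain ⟨j, hj⟩ := mem_matched.mp hi.1
    refine ⟨(hT k hk.1 i hi.2).dist_le, ?_⟩
    have h1 := (hf.precedes_of_eq_none hj hkn).dist_le
    have h2 := abs_sub_le (x i) (y j) u
    have h3 := abs_sub_le (x k) u (y j)
    rw [abs_sub_comm u (y j)] at h3
    linarith [hy j]
  have hr := hx ((matched f \ T).filter fun i => u ≤ x i) ⟨u + |x k - u|, fun i hi => by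
    rw [Finset.mem_filter] at hi
    have := key i hi.1
    rw [abs_of_nonneg (sub_nonneg.mpr hi.2)] at this
    constructor <;> linarith⟩
  have hl := hx ((matched f \ T).filter fun i => ¬ u ≤ x i)
    ⟨u - |x k - u| - 2 * δ, fun i hi => by
      rw [Finset.mem_filter] at hi
      have := key i hi.1
      rw [abs_of_neg (by linarith [not_le.mp hi.2] : x i - u < 0)] at this
      constructor <;> linarith⟩
  have hsum := Finset.card_filter_add_card_filter_not (s := matched f \ T) (fun i => u ≤ x i)
  rw [← hsum]
  push_cast
  linarith

/-! ### Improving a pair of facilities at the same place -/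

/-- The sign `σ` encodes the direction, 1 for right and -1 for left, so that mirror-image arguments
are made once. -/
theorem abs_sub_shift {σ z u δ : ℝ} (hσ : σ = 1 ∨ σ = -1) (hδ : 0 ≤ δ) (h : δ ≤ σ * (z - u)) :
    |z - (u + σ * δ)| = |z - u| - δ ∧ |z - (u + -σ * δ)| = |z - u| + δ := by
  rcases hσ with rfl | rfl
  · have h : δ ≤ z - u := by linarith
    rw [abs_of_nonneg (by linarith : 0 ≤ z - u), abs_of_nonneg (by linarith),
      abs_of_nonneg (by linarith)]
    constructor <;> ring
  · have h : δ ≤ u - z := by linarith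
    rw [abs_of_nonpos (by linarith : z - u ≤ 0), abs_of_nonpos (by linarith),
      abs_of_nonpos (by linarith)]
    constructor <;> ring

theorem abs_shift_sub {σ u δ : ℝ} (hσ : σ = 1 ∨ σ = -1) (hδ : 0 ≤ δ) :
    |(u + σ * δ) - u| ≤ δ := by
  rcases hσ with rfl | rfl
  · rw [show u + 1 * δ - u = δ by ring, abs_of_nonneg hδ]
  · rw [show u + -1 * δ - u = -δ by ring, abs_neg, abs_of_nonneg hδ]

/-- The displaced point lies between `u` and `z`. This is why the side towards which a facility
moves must contain an agent. -/
theorem shift_mem_Icc {σ u z δ : ℝ} (hσ : σ = 1 ∨ σ = -1) (hδ : 0 ≤ δ)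
    (hu : u ∈ Set.Icc (0 : ℝ) 1) (hz : z ∈ Set.Icc (0 : ℝ) 1) (h : δ ≤ σ * (z - u)) :
    u + σ * δ ∈ Set.Icc (0 : ℝ) 1 := by
  rcases hσ with rfl | rfl
  · constructor <;> linarith [hu.1, hz.2]
  · constructor <;> linarith [hu.2, hz.1]

/-- The agents of `T` at distance at least `δ` from `u`, on the side given by the sign `σ`. -/
noncomputable def sideSet {n : ℕ} (x : Fin n → ℝ) (u δ σ : ℝ) (T : Finset (Fin n)) :
    Finset (Fin n) :=
  T.filter fun i => δ ≤ σ * (x i - u)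

theorem mem_sideSet {n : ℕ} {x : Fin n → ℝ} {u δ σ : ℝ} {T : Finset (Fin n)} {i : Fin n} :
    i ∈ sideSet x u δ σ T ↔ i ∈ T ∧ δ ≤ σ * (x i - u) := Finset.mem_filter

/-- Agents on neither side are within δ of `u`, in a single window of length 2δ. -/
theorem IsSpread.card_le_add_sideSet {n : ℕ} {x : Fin n → ℝ} {δ K : ℝ} (hx : IsSpread x δ K)
    (u : ℝ) {σ : ℝ} (hσ : σ = 1 ∨ σ = -1) (T : Finset (Fin n)) :
    (T.card : ℝ) ≤ (sideSet x u δ σ T).card + (sideSet x u δ (-σ) T).card + K := by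
  classical
  have hw := hx (T.filter fun i => ¬ δ ≤ σ * (x i - u) ∧ ¬ δ ≤ -σ * (x i - u)) ⟨u - δ, fun i hi => by
    simp only [Finset.mem_filter, not_le] at hi
    rcases hσ with rfl | rfl
    · constructor <;> linarith [hi.2.1, hi.2.2]
    · constructor <;> linarith [hi.2.1, hi.2.2]⟩
  have hsub : T ⊆ (sideSet x u δ σ T ∪ sideSet x u δ (-σ) T) ∪
      T.filter fun i => ¬ δ ≤ σ * (x i - u) ∧ ¬ δ ≤ -σ * (x i - u) := by
    intro i hi
    simp only [Finset.mem_union, mem_sideSet, Finset.mem_filter]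
    tauto
  have h1 := (Finset.card_le_card hsub).trans (Finset.card_union_le _ _)
  have h2 := Finset.card_union_le (sideSet x u δ σ T) (sideSet x u δ (-σ) T)
  have h3 : (T.card : ℝ) ≤ ((sideSet x u δ σ T).card + (sideSet x u δ (-σ) T).card +
    (T.filter fun i => ¬ δ ≤ σ * (x i - u) ∧ ¬ δ ≤ -σ * (x i - u)).card : ℕ) := by
    exact_mod_cast h1.trans (by omega)
  push_cast at h3
  linarith

/-- Moving all the facilities to the side where more agents are accommodated. -/
theorem exists_stable_of_shift {n m : ℕ} (c : Fin m → ℕ) {x : Fin n → ℝ} {u δ K σ : ℝ}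
    {T : Finset (Fin n)} (hσ : σ = 1 ∨ σ = -1) (hδ : 0 ≤ δ)
    (hx : ∀ i, x i ∈ Set.Icc (0 : ℝ) 1) (hu : u ∈ Set.Icc (0 : ℝ) 1)
    (hcard : T.card = ∑ j, c j) (hT : IsClosestSet x u T) (hK : IsSpread x δ K)
    (hne : (sideSet x u δ σ T).Nonempty) :
    ∃ y : Fin m → ℝ, (∀ j, y j ∈ Set.Icc (0 : ℝ) 1) ∧ ∃ f, IsStable c x y f ∧
      ∑ i ∈ T, (1 - |x i - u|) +
        δ * ((sideSet x u δ σ T).card - (sideSet x u δ (-σ) T).card - 5 * K) ≤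
        matchingWelfare x y f := by
  classical
  obtain ⟨i₀, hi₀⟩ := hne
  have hy : u + σ * δ ∈ Set.Icc (0 : ℝ) 1 :=
    shift_mem_Icc hσ hδ hu (hx i₀) (mem_sideSet.mp hi₀).2
  refine ⟨fun _ => u + σ * δ, fun _ => hy, ?_⟩
  obtain ⟨f, hf⟩ := exists_isStable c x fun _ => u + σ * δ
  refine ⟨f, hf, le_trans ?_ (hf.sum_add_le_matchingWelfare (G := sideSet x u δ σ T ∩ matched f)
    (fun i _ => abs_sub_le_one_of_mem_Icc (hx i) hy) hcard (fun _ => abs_shift_sub hσ hδ)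
    (fun i hi => (mem_sideSet.mp (Finset.mem_inter.mp hi).1).1) ?_)⟩
  · have h1 := (hf.card_sdiff_le hcard hT (fun _ => abs_shift_sub hσ hδ) hK).1
    have h2 := hK.card_le_add_sideSet u hσ T
    have h3 : ((sideSet x u δ σ T).card : ℝ) ≤
        (sideSet x u δ σ T ∩ matched f).card + (T \ matched f).card := by
      rw [← Finset.card_inter_add_card_sdiff (sideSet x u δ σ T) (matched f)]
      push_cast
      gcongr
      exact Finset.filter_subset _ _
    -- With side counts S and S', at least S - 2K agents gain, and T has at most S + S' + K agents:
    -- 2(S - 2K) - (S + S' + K) = S - S' - 5K.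
    have h4 : (sideSet x u δ σ T).card - (sideSet x u δ (-σ) T).card - 5 * K ≤
        2 * ((sideSet x u δ σ T ∩ matched f).card : ℝ) - T.card := by linarith
    linarith [mul_le_mul_of_nonneg_left h4 hδ]
  · intro i hi
    rw [Finset.mem_inter, mem_sideSet] at hi
    obtain ⟨j, hj⟩ := mem_matched.mp hi.2
    exact ⟨j, hj, (abs_sub_shift hσ hδ hi.1.2).1.le⟩

/-- Two facilities moved apart: if some agent on the side of `a` is accommodated by `b`, then `a` is
full of agents on its side, and no agent on the side of `b` is accommodated by `a`. -/
theorem IsStable.card_split_of_crossing {n : ℕ} {c : Fin 2 → ℕ} {x : Fin n → ℝ} {y : Fin 2 → ℝ}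
    {f : Fin n → Option (Fin 2)} (hf : IsStable c x y f) {u δ K σ : ℝ} {T : Finset (Fin n)}
    (hσ : σ = 1 ∨ σ = -1) (hδ : 0 < δ) (hcard : T.card = ∑ j, c j) (hT : IsClosestSet x u T)
    (hK : IsSpread x δ K) {a b : Fin 2} (hab : a ≠ b) (hya : y a = u + σ * δ)
    (hyb : y b = u + -σ * δ) (hyu : ∀ j, |y j - u| ≤ δ)
    {k : Fin n} (hk : δ ≤ σ * (x k - u)) (hfk : f k = some b) :
    (c a : ℝ) ≤ ((sideSet x u δ σ T).filter fun i => f i = some a).card + 3 * K ∧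
      ((sideSet x u δ (-σ) T).card : ℝ) ≤
        ((sideSet x u δ (-σ) T).filter fun i => f i = some b).card + 2 * K := by
  classical
  have hσ' : -σ = 1 ∨ -σ = -1 := by
    rcases hσ with rfl | rfl
    · exact Or.inr rfl
    · exact Or.inl (neg_neg 1)
  have hkd := abs_sub_shift hσ hδ.le hk
  rw [← hya, ← hyb] at hkd
  have hpref : ∀ j', f k = some j' → |x k - y a| < |x k - y j'| := by
    intro j' h
    obtain rfl : j' = b := Option.some.inj (h.symm.trans hfk)
    linarith
  have hfull := hf.card_eq_of_prefers hpref
  -- If `l` were at `a` while `k` is at `b`, each would prefer the other's facility. Then `l`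
  -- precedes `k` at `a` and `k` precedes `l` at `b`, and the two inequalities, written with
  -- distances to `u`, add up to 4δ ≤ 0.
  have hno : ∀ l, δ ≤ -σ * (x l - u) → f l ≠ some a := by
    intro l hl hfl
    have hld := abs_sub_shift hσ' hδ.le hl
    rw [neg_neg, ← hya, ← hyb] at hld
    have h1 := (hf.precedes_of_prefers hfl hpref).dist_le
    have h2 := (hf.precedes_of_prefers (i := k) (k := l) hfk fun j' h => by
      obtain rfl : j' = a := Option.some.inj (h.symm.trans hfl)
      linarith).dist_le
    linarith
  have hsd := hf.card_sdiff_le hcard hT hyu hK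
  constructor
  -- Of the agents filling `a`, at most 2K lie outside `T` and at most K within δ of `u`; none lies
  -- on the side of `b`.
  · have hw := hK ((Finset.univ.filter fun l => f l = some a).filter fun i =>
        ¬ δ ≤ σ * (x i - u) ∧ ¬ δ ≤ -σ * (x i - u)) ⟨u - δ, fun i hi => by
      simp only [Finset.mem_filter, not_le] at hi
      rcases hσ with rfl | rfl
      · constructor <;> linarith [hi.2.1, hi.2.2]
      · constructor <;> linarith [hi.2.1, hi.2.2]⟩
    have hsub : (Finset.univ.filter fun l => f l = some a) ⊆
        ((sideSet x u δ σ T).filter fun i => f i = some a) ∪ (matched f \ T) ∪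
        ((Finset.univ.filter fun l => f l = some a).filter fun i =>
          ¬ δ ≤ σ * (x i - u) ∧ ¬ δ ≤ -σ * (x i - u)) := by
      intro i hi
      simp only [Finset.mem_filter, Finset.mem_univ, true_and] at hi
      have h1 : ¬ δ ≤ -σ * (x i - u) := fun h => hno i h hi
      have h2 : i ∈ matched f := mem_matched.mpr ⟨a, hi⟩
      simp only [Finset.mem_union, Finset.mem_filter, mem_sideSet, Finset.mem_sdiff,
        Finset.mem_univ, true_and]
      tauto
    have h1 := (Finset.card_le_card hsub).trans (Finset.card_union_le _ _)
    have h2 := Finset.card_union_le ((sideSet x u δ σ T).filter fun i => f i = some a)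
      (matched f \ T)
    have h3 : (c a : ℝ) ≤ (((sideSet x u δ σ T).filter fun i => f i = some a).card +
        (matched f \ T).card + ((Finset.univ.filter fun l => f l = some a).filter fun i =>
          ¬ δ ≤ σ * (x i - u) ∧ ¬ δ ≤ -σ * (x i - u)).card : ℕ) := by
      rw [← hfull]
      exact_mod_cast h1.trans (by omega)
    push_cast at h3
    linarith [hsd.2]
  · have hsub : sideSet x u δ (-σ) T ⊆
        ((sideSet x u δ (-σ) T).filter fun i => f i = some b) ∪ (T \ matched f) := by
      intro i hi
      rw [Finset.mem_union, Finset.mem_filter, Finset.mem_sdiff]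
      have hi' := mem_sideSet.mp hi
      by_cases hm : i ∈ matched f
      · obtain ⟨j, hj⟩ := mem_matched.mp hm
        have hja : j ≠ a := by
          rintro rfl
          exact hno i hi'.2 hj
        have hjb : j = b := by omega
        exact Or.inl ⟨hi, hjb ▸ hj⟩
      · exact Or.inr ⟨hi'.1, hm⟩
    have h1 := (Finset.card_le_card hsub).trans (Finset.card_union_le _ _)
    have h2 : ((sideSet x u δ (-σ) T).card : ℝ) ≤
      (((sideSet x u δ (-σ) T).filter fun i => f i = some b).card + (T \ matched f).card : ℕ) := by
      exact_mod_cast h1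
    push_cast at h2
    linarith [hsd.1]

theorem IsStable.card_split_of_not_crossing {n : ℕ} {c : Fin 2 → ℕ} {x : Fin n → ℝ}
    {y : Fin 2 → ℝ} {f : Fin n → Option (Fin 2)} (hf : IsStable c x y f) {u δ K σ : ℝ}
    {T : Finset (Fin n)} (hcard : T.card = ∑ j, c j) (hT : IsClosestSet x u T)
    (hK : IsSpread x δ K) (hyu : ∀ j, |y j - u| ≤ δ) {a b : Fin 2} (hab : a ≠ b)
    (hno : ∀ k, δ ≤ σ * (x k - u) → f k ≠ some b) :
    ((sideSet x u δ σ T).card : ℝ) ≤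
      ((sideSet x u δ σ T).filter fun i => f i = some a).card + 2 * K := by
  classical
  have hsub : sideSet x u δ σ T ⊆
      ((sideSet x u δ σ T).filter fun i => f i = some a) ∪ (T \ matched f) := by
    intro i hi
    rw [Finset.mem_union, Finset.mem_filter, Finset.mem_sdiff]
    have hi' := mem_sideSet.mp hi
    by_cases hm : i ∈ matched f
    · obtain ⟨j, hj⟩ := mem_matched.mp hm
      have hjb : j ≠ b := by
        rintro rfl
        exact hno i hi'.2 hj
      have hja : j = a := by omega
      exact Or.inl ⟨hi, hja ▸ hj⟩
    · exact Or.inr ⟨hi'.1, hm⟩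
  have h1 := (Finset.card_le_card hsub).trans (Finset.card_union_le _ _)
  have h2 : ((sideSet x u δ σ T).card : ℝ) ≤
    (((sideSet x u δ σ T).filter fun i => f i = some a).card + (T \ matched f).card : ℕ) := by
    exact_mod_cast h1
  push_cast at h2
  linarith [(hf.card_sdiff_le hcard hT hyu hK).1]

/-- Two facilities at the same place can be improved by moving them together or apart. -/
theorem exists_stable_gain_of_common {n : ℕ} (c : Fin 2 → ℕ) {x : Fin n → ℝ} {u δ K C : ℝ}
    {T : Finset (Fin n)} (hδ : 0 < δ) (hx : ∀ i, x i ∈ Set.Icc (0 : ℝ) 1)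
    (hu : u ∈ Set.Icc (0 : ℝ) 1) (hcard : T.card = ∑ j, c j) (hT : IsClosestSet x u T)
    (hK : IsSpread x δ K) (hc : ∀ j, C ≤ c j) (hKC : 11 * K < C) :
    ∃ y : Fin 2 → ℝ, (∀ j, y j ∈ Set.Icc (0 : ℝ) 1) ∧ ∃ f, IsStable c x y f ∧
      ∑ i ∈ T, (1 - |x i - u|) + δ * (C - 11 * K) ≤ matchingWelfare x y f := by
  classical
  have hK0 : 0 ≤ K := by
    have := hK ∅ ⟨0, by simp⟩
    simpa using this
  have h1 : (1 : ℝ) = 1 ∨ (1 : ℝ) = -1 := Or.inl rfl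
  have h1' : (-1 : ℝ) = 1 ∨ (-1 : ℝ) = -1 := Or.inr rfl
  have hTc : (T.card : ℝ) = c 0 + c 1 := by
    rw [hcard, Fin.sum_univ_two, Nat.cast_add]
  have hsides := hK.card_le_add_sideSet u h1 T
  -- If one side has at least `C` more agents of `T` than the other, both facilities move there.
  -- Otherwise each moves to its own side, and both sides are nonempty.
  by_cases hR : C ≤ (sideSet x u δ 1 T).card - ((sideSet x u δ (-1) T).card : ℝ)
  · have hpos : (0 : ℝ) < (sideSet x u δ 1 T).card := by
      have : (0 : ℝ) ≤ (sideSet x u δ (-1) T).card := Nat.cast_nonneg _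
      linarith
    obtain ⟨y, hy, f, hf, h⟩ := exists_stable_of_shift c h1 hδ.le hx hu hcard hT hK
      (Finset.card_pos.mp (by exact_mod_cast hpos))
    refine ⟨y, hy, f, hf, le_trans ?_ h⟩
    gcongr
    linarith
  by_cases hL : C ≤ (sideSet x u δ (-1) T).card - ((sideSet x u δ 1 T).card : ℝ)
  · have hpos : (0 : ℝ) < (sideSet x u δ (-1) T).card := by
      have : (0 : ℝ) ≤ (sideSet x u δ 1 T).card := Nat.cast_nonneg _
      linarith
    obtain ⟨y, hy, f, hf, h⟩ := exists_stable_of_shift c h1' hδ.le hx hu hcard hT hK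
      (Finset.card_pos.mp (by exact_mod_cast hpos))
    refine ⟨y, hy, f, hf, le_trans ?_ h⟩
    rw [neg_neg]
    gcongr
    linarith
  push Not at hR hL
  have hc0 := hc 0
  have hc1 := hc 1
  have hpR : (sideSet x u δ 1 T).Nonempty := by
    rw [← Finset.card_pos]
    have : (0 : ℝ) < (sideSet x u δ 1 T).card := by linarith
    exact_mod_cast this
  have hpL : (sideSet x u δ (-1) T).Nonempty := by
    rw [← Finset.card_pos]
    have : (0 : ℝ) < (sideSet x u δ (-1) T).card := by linarith
    exact_mod_cast this
  obtain ⟨iR, hiR⟩ := hpR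
  obtain ⟨iL, hiL⟩ := hpL
  set y : Fin 2 → ℝ := ![u + 1 * δ, u + -1 * δ] with hydef
  have hy0 : y 0 = u + 1 * δ := rfl
  have hy1 : y 1 = u + -1 * δ := rfl
  have hy : ∀ j, y j ∈ Set.Icc (0 : ℝ) 1 := by
    rw [Fin.forall_fin_two, hy0, hy1]
    exact ⟨shift_mem_Icc h1 hδ.le hu (hx iR) (mem_sideSet.mp hiR).2,
      shift_mem_Icc h1' hδ.le hu (hx iL) (mem_sideSet.mp hiL).2⟩
  have hyu : ∀ j, |y j - u| ≤ δ := by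
    rw [Fin.forall_fin_two, hy0, hy1]
    exact ⟨abs_shift_sub h1 hδ.le, abs_shift_sub h1' hδ.le⟩
  obtain ⟨f, hf⟩ := exists_isStable c x y
  set G0 := (sideSet x u δ 1 T).filter fun i => f i = some 0 with hG0
  set G1 := (sideSet x u δ (-1) T).filter fun i => f i = some 1 with hG1
  have hdisj : Disjoint G0 G1 := by
    rw [Finset.disjoint_left]
    intro i hi hi'
    rw [hG0, Finset.mem_filter] at hi
    rw [hG1, Finset.mem_filter] at hi'
    have := Option.some.inj (hi.2.symm.trans hi'.2)
    omega
  have hGcard : ((G0 ∪ G1).card : ℝ) = G0.card + G1.card := by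
    rw [Finset.card_union_of_disjoint hdisj, Nat.cast_add]
  -- Let R and L be the side counts, so |T| ≤ R + L + K. If an agent on the right is at the left
  -- facility, then |G0| ≥ c 0 - 3K and |G1| ≥ L - 2K, while R - L < C gives 2L ≥ |T| - K - C; this
  -- case produces the 11. Without crossings, |G0| + |G1| ≥ R + L - 4K, and |T| = c 0 + c 1 ≥ 2C
  -- suffices.
  have hcount : C - 11 * K ≤ 2 * ((G0 ∪ G1).card : ℝ) - T.card := by
    rw [hGcard]
    by_cases hcr0 : ∃ k, δ ≤ 1 * (x k - u) ∧ f k = some 1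
    · obtain ⟨k, hk, hfk⟩ := hcr0
      obtain ⟨h2, h3⟩ := hf.card_split_of_crossing h1 hδ hcard hT hK (a := 0) (b := 1)
        (by decide) hy0 hy1 hyu hk hfk
      linarith
    by_cases hcr1 : ∃ k, δ ≤ -1 * (x k - u) ∧ f k = some 0
    · obtain ⟨k, hk, hfk⟩ := hcr1
      obtain ⟨h2, h3⟩ := hf.card_split_of_crossing h1' hδ hcard hT hK (a := 1) (b := 0)
        (by decide) hy1 (by rw [neg_neg, hy0]) hyu hk hfk
      rw [neg_neg] at h3
      linarith
    · push Not at hcr0 hcr1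
      have h2 := hf.card_split_of_not_crossing hcard hT hK hyu (a := 0) (b := 1)
        (by decide) hcr0
      have h3 := hf.card_split_of_not_crossing hcard hT hK hyu (a := 1) (b := 0)
        (by decide) hcr1
      linarith
  refine ⟨y, hy, f, hf, le_trans ?_ (hf.sum_add_le_matchingWelfare (G := G0 ∪ G1)
    (fun i j => abs_sub_le_one_of_mem_Icc (hx i) (hy j)) hcard hyu ?_ ?_)⟩
  · gcongr
  · refine Finset.union_subset ?_ ?_ <;>
    exact (Finset.filter_subset _ _).trans (Finset.filter_subset _ _)
  · intro i hi
    rcases Finset.mem_union.mp hi with hi | hi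
    · rw [hG0, Finset.mem_filter, mem_sideSet] at hi
      exact ⟨0, hi.2, (abs_sub_shift h1 hδ.le hi.1.2).1.le⟩
    · rw [hG1, Finset.mem_filter, mem_sideSet] at hi
      exact ⟨1, hi.2, (abs_sub_shift h1' hδ.le hi.1.2).1.le⟩

/-! ### Improving two facilities that are far apart -/

/-- Otherwise all of `T` would be within δ of `u`, too many agents for one window. Hence the closest
set of a facility displaced by at most δ from an agent still contains that agent. -/
theorem IsSpread.mem_of_isClosestSet {n : ℕ} {x : Fin n → ℝ} {δ K u : ℝ} (hK : IsSpread x δ K)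
    {T : Finset (Fin n)} (hT : IsClosestSet x u T) (hc : K < T.card) {i : Fin n}
    (hi : |x i - u| ≤ δ) : i ∈ T := by
  by_contra hiT
  refine absurd (hK T ⟨u - δ, fun k hk => ?_⟩) (not_le.mpr hc)
  have := abs_le.mp ((hT k hk i hiT).dist_le.trans hi)
  constructor <;> linarith [this.1, this.2]

/-- An agent strictly between two others is closer to any point than one of them. -/
theorem mem_of_between {n : ℕ} {x : Fin n → ℝ} {u : ℝ} {T : Finset (Fin n)}
    (hT : IsClosestSet x u T) {i k l : Fin n} (hi : i ∈ T) (hk : k ∈ T) (h1 : x i < x l)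
    (h2 : x l < x k) : l ∈ T := by
  by_contra hl
  have hi' := (hT i hi l hl).dist_le
  have hk' := (hT k hk l hl).dist_le
  rcases le_total u (x l) with h | h
  · rw [abs_of_nonneg (by linarith), abs_of_nonneg (by linarith)] at hk'
    linarith
  · rw [abs_of_nonpos (by linarith), abs_of_nonpos (by linarith)] at hi'
    linarith

open Classical in
theorem card_between_le {n : ℕ} {x : Fin n → ℝ} (hx : Function.Injective x) {u : ℝ}
    {T : Finset (Fin n)} (hT : IsClosestSet x u T) {i k : Fin n} (hi : i ∈ T) (hk : k ∈ T) :
    (Finset.univ.filter fun l => x i ≤ x l ∧ x l ≤ x k).card ≤ T.card := by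
  refine Finset.card_le_card fun l hl => ?_
  simp only [Finset.mem_filter, Finset.mem_univ, true_and] at hl
  rcases hl.1.eq_or_lt with h | h
  · exact hx h ▸ hi
  rcases hl.2.eq_or_lt with h' | h'
  · exact hx h' ▸ hk
  exact mem_of_between hT hi hk h h'

-- An agent `l` in both sets would cut the stretch from `i` to `k` into a piece inside `S` and a
-- piece inside `T`. If `l` lies in the stretch it is counted twice, and otherwise one piece is
-- empty, so the stretch would have fewer than |S| + |T| agents.
open Classical in
theorem disjoint_of_card_between {n : ℕ} {x : Fin n → ℝ} (hx : Function.Injective x) {u v : ℝ}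
    {S T : Finset (Fin n)} (hS : IsClosestSet x u S) (hT : IsClosestSet x v T) {i k : Fin n}
    (hi : i ∈ S) (hk : k ∈ T)
    (hcard : S.card + T.card ≤ (Finset.univ.filter fun l => x i ≤ x l ∧ x l ≤ x k).card) :
    Disjoint S T := by
  rw [Finset.disjoint_left]
  intro l hlS hlT
  have h1 := card_between_le hx hS hi hlS
  have h2 := card_between_le hx hT hlT hk
  have hsub : (Finset.univ.filter fun m => x i ≤ x m ∧ x m ≤ x k) ⊆
      (Finset.univ.filter fun m => x i ≤ x m ∧ x m ≤ x l) ∪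
      (Finset.univ.filter fun m => x l ≤ x m ∧ x m ≤ x k) := by
    intro m hm
    simp only [Finset.mem_filter, Finset.mem_univ, true_and, Finset.mem_union] at hm ⊢
    rcases le_total (x m) (x l) with h | h
    · exact Or.inl ⟨hm.1, h⟩
    · exact Or.inr ⟨h, hm.2⟩
  have h3 := Finset.card_le_card hsub
  have h4 := Finset.card_union_add_card_inter
    (Finset.univ.filter fun m => x i ≤ x m ∧ x m ≤ x l)
    (Finset.univ.filter fun m => x l ≤ x m ∧ x m ≤ x k)
  by_cases hl : x i ≤ x l ∧ x l ≤ x k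
  · have h5 : 0 < ((Finset.univ.filter fun m => x i ≤ x m ∧ x m ≤ x l) ∩
        (Finset.univ.filter fun m => x l ≤ x m ∧ x m ≤ x k)).card :=
      Finset.card_pos.mpr ⟨l, by simp [hl]⟩
    omega
  · have hS0 : 0 < S.card := Finset.card_pos.mpr ⟨i, hi⟩
    have hT0 : 0 < T.card := Finset.card_pos.mpr ⟨k, hk⟩
    rw [not_and_or, not_le, not_le] at hl
    rcases hl with hl | hl
    · have : (Finset.univ.filter fun m => x i ≤ x m ∧ x m ≤ x l) = ∅ := by
        ext m
        simp only [Finset.mem_filter, Finset.mem_univ, true_and, Finset.notMem_empty, iff_false]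
        rintro ⟨h, h'⟩
        linarith
      rw [this] at h3 h4
      simp only [Finset.card_empty, Finset.empty_union] at h3 h4
      omega
    · have : (Finset.univ.filter fun m => x l ≤ x m ∧ x m ≤ x k) = ∅ := by
        ext m
        simp only [Finset.mem_filter, Finset.mem_univ, true_and, Finset.notMem_empty, iff_false]
        rintro ⟨h, h'⟩
        linarith
      rw [this] at h3 h4
      simp only [Finset.card_empty, Finset.union_empty] at h3 h4
      omega

/-- Two facilities with enough agents between them: moving facility `d` by `δ` improves the welfare
if most of its agents are on that side. -/
theorem exists_stable_gain_of_apart {n : ℕ} (c : Fin 2 → ℕ) {x : Fin n → ℝ} {δ K σ : ℝ}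
    {T : Fin 2 → Finset (Fin n)} {g : Fin 2 → Fin n} (hσ : σ = 1 ∨ σ = -1) (hδ : 0 < δ)
    (hx : ∀ i, x i ∈ Set.Icc (0 : ℝ) 1) (hinj : Function.Injective x)
    (hcard : ∀ j, (T j).card = c j) (hK : IsSpread x δ K) (hc : ∀ j, K < c j) (hcn : ∀ j, c j ≤ n) {a b d : Fin 2} (hab : a ≠ b)
    (hbet : c a + c b ≤ (Finset.univ.filter fun l => x (g a) ≤ x l ∧ x l ≤ x (g b)).card)
    (hne : (sideSet x (x (g d)) δ σ (T d)).Nonempty) :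
    ∃ y : Fin 2 → ℝ, (∀ j, y j ∈ Set.Icc (0 : ℝ) 1) ∧ ∃ f, IsStable c x y f ∧
      ∑ j, ∑ i ∈ T j, (1 - |x i - x (g j)|) +
        δ * (2 * (sideSet x (x (g d)) δ σ (T d)).card - c d) ≤ matchingWelfare x y f := by
  classical
  set y : Fin 2 → ℝ := Function.update (fun j => x (g j)) d (x (g d) + σ * δ) with hydef
  have hyd : y d = x (g d) + σ * δ := Function.update_self ..
  have hyne : ∀ j, j ≠ d → y j = x (g j) := fun j hj => Function.update_of_ne hj ..
  have hy : ∀ j, y j ∈ Set.Icc (0 : ℝ) 1 := by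
    intro j
    by_cases hj : j = d
    · obtain ⟨i, hi⟩ := hne
      rw [hj, hyd]
      exact shift_mem_Icc hσ hδ.le (hx _) (hx i) (mem_sideSet.mp hi).2
    · rw [hyne j hj]
      exact hx _
  have hyg : ∀ j, |y j - x (g j)| ≤ δ := by
    intro j
    by_cases hj : j = d
    · rw [hj, hyd]
      exact abs_shift_sub hσ hδ.le
    · rw [hyne j hj, sub_self, abs_zero]
      exact hδ.le
  -- The closest sets at the new positions turn out to be disjoint, so they can all be accommodated
  -- at once and their total utility is attained by a stable matching.
  choose T' hcard' hT' using fun j => exists_isClosestSet x (y j) (hcn j)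
  have hmem : ∀ j, g j ∈ T' j := fun j => hK.mem_of_isClosestSet (hT' j)
    (by rw [hcard']; exact hc j) (by rw [abs_sub_comm]; exact hyg j)
  have hdab : Disjoint (T' a) (T' b) := by
    refine disjoint_of_card_between hinj (hT' a) (hT' b) (hmem a) (hmem b) ?_
    rw [hcard', hcard']
    convert hbet
  obtain ⟨f, hf, hfw⟩ := exists_isStable_of_disjoint hT' hcard' (by
    intro j j' hne
    rcases (by omega : (j = a ∧ j' = b) ∨ (j = b ∧ j' = a)) with ⟨rfl, rfl⟩ | ⟨rfl, rfl⟩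
    · exact hdab
    · exact hdab.symm)
  refine ⟨y, hy, f, hf, ?_⟩
  rw [hfw]
  have hd1 : ∀ i j, |x i - y j| ≤ 1 := fun i j => abs_sub_le_one_of_mem_Icc (hx i) (hy j)
  have hTT : ∀ j, ∑ i ∈ T j, (1 - |x i - y j|) ≤ ∑ i ∈ T' j, (1 - |x i - y j|) := fun j =>
    (hT' j).sum_le (by rw [hcard, hcard']) fun i => hd1 i j
  rw [Fintype.sum_eq_add_sum_compl d, Fintype.sum_eq_add_sum_compl d, add_right_comm]
  refine add_le_add (le_trans ?_ (hTT d)) (Finset.sum_le_sum fun j hj => ?_)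
  · rw [← hcard d, hyd]
    exact sum_add_le_sum_of_gain (abs_shift_sub hσ hδ.le) (Finset.filter_subset _ _) fun i hi =>
      (abs_sub_shift hσ hδ.le (mem_sideSet.mp hi).2).1.le
  · have hjd : j ≠ d := by simpa using hj
    have := hTT j
    rwa [hyne j hjd] at this ⊢

/-! ### Percentile mechanisms that are not Equilibrium Stable -/

/-- Disjoint sets of agents filling two facilities form a Nash equilibrium if no agent prefers a
facility whose agents are not all closer. -/
theorem exists_nash_of_full {N : ℕ} {q : Fin 2 → ℝ} {x : Fin N → ℝ} {y : Fin 2 → ℝ} {a b : Fin 2}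
    (hab : a ≠ b) (A B : Fin N → Prop) [DecidablePred A] [DecidablePred B]
    (hdisj : ∀ i, A i → ¬ B i)
    (hAc : (Finset.univ.filter A).card = capacity q N a)
    (hBc : (Finset.univ.filter B).card = capacity q N b) (hd : ∀ i j, |x i - y j| ≤ 1)
    (hA : ∀ i, A i → |x i - y a| ≤ |x i - y b| ∨ ∀ k, B k → |x k - y b| < |x i - y b|)
    (hB : ∀ i, B i → |x i - y b| ≤ |x i - y a| ∨ ∀ k, A k → |x k - y a| < |x i - y a|)
    (hO : ∀ i, ¬ A i → ¬ B i → (∀ k, A k → |x k - y a| < |x i - y a|) ∧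
      ∀ k, B k → |x k - y b| < |x i - y b|) :
    ∃ s, IsNashEquilibrium q x y s ∧ socialWelfare q x y s =
      ∑ i, if A i then 1 - |x i - y a| else if B i then 1 - |x i - y b| else 0 := by
  classical
  set f : Fin N → Option (Fin 2) := fun i => if A i then some a else if B i then some b else none
    with hfdef
  have hfa : ∀ i, f i = some a ↔ A i := by
    intro i
    simp only [hfdef]
    split_ifs with h1 h2 <;> simp [h1, hab.symm]
  have hfb : ∀ i, f i = some b ↔ B i := by
    intro i
    simp only [hfdef]
    split_ifs with h1 h2
    · simp [hdisj i h1, hab]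
    · simp [h2]
    · simp [h2]
  have hjab : ∀ j : Fin 2, j = a ∨ j = b := by
    intro j
    omega
  have hca : (Finset.univ.filter fun i => f i = some a).card = capacity q N a := by
    simp only [hfa]
    convert hAc
  have hcb : (Finset.univ.filter fun i => f i = some b).card = capacity q N b := by
    simp only [hfb]
    convert hBc
  have hfull : ∀ j, (Finset.univ.filter fun i => f i = some j).card = capacity q N j := by
    intro j
    rcases hjab j with rfl | rfl
    · exact hca
    · exact hcb
  have hcrit : ∀ i j, (∀ k, f k = some j → |x k - y j| < |x i - y j|) → capacity q N j ≤
      (Finset.univ.filter fun k => f k = some j ∧ Precedes x (y j) k i).card := by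
    intro i j h
    rw [← hfull j]
    refine Finset.card_le_card fun k hk => ?_
    simp only [Finset.mem_filter, Finset.mem_univ, true_and] at hk ⊢
    exact ⟨hk, Or.inl (h k hk)⟩
  have hf : IsStable (capacity q N) x y f := by
    refine ⟨fun j => (hfull j).le, fun i j => ?_⟩
    by_cases hAi : A i
    · rcases hjab j with rfl | rfl
      · exact Or.inl ⟨j, (hfa i).mpr hAi, le_rfl⟩
      · rcases hA i hAi with h | h
        · exact Or.inl ⟨a, (hfa i).mpr hAi, h⟩
        · exact Or.inr (hcrit i j fun k hk => h k ((hfb k).mp hk))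
    by_cases hBi : B i
    · rcases hjab j with rfl | rfl
      · rcases hB i hBi with h | h
        · exact Or.inl ⟨b, (hfb i).mpr hBi, h⟩
        · exact Or.inr (hcrit i j fun k hk => h k ((hfa k).mp hk))
      · exact Or.inl ⟨j, (hfb i).mpr hBi, le_rfl⟩
    obtain ⟨h1, h2⟩ := hO i hAi hBi
    right
    rcases hjab j with rfl | rfl
    · exact hcrit i j fun k hk => h1 k ((hfa k).mp hk)
    · exact hcrit i j fun k hk => h2 k ((hfb k).mp hk)
  obtain ⟨s, hs, h⟩ := hf.exists_nash hd
  refine ⟨s, hs, h.trans (Finset.sum_congr rfl fun i _ => ?_)⟩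
  simp only [hfdef]
  split_ifs <;> rfl

theorem card_filter_fin_Ico {N lo hi : ℕ} (h : hi ≤ N) :
    (Finset.univ.filter fun i : Fin N => lo ≤ (i : ℕ) ∧ (i : ℕ) < hi).card = hi - lo := by
  rw [← Nat.card_Ico, ← Finset.card_map Fin.valEmbedding]
  congr 1
  ext t
  simp only [Finset.mem_map, Finset.mem_filter, Finset.mem_univ, true_and, Fin.valEmbedding_apply,
    Finset.mem_Ico]
  constructor
  · rintro ⟨i, hi, rfl⟩
    exact hi
  · intro ht
    exact ⟨⟨t, by omega⟩, ht, rfl⟩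

theorem card_filter_fin_Ico_sdiff {N lo hi s t : ℕ} (h : hi ≤ N) (hs : lo ≤ s)
    (ht : t ≤ hi) :
    (Finset.univ.filter fun i : Fin N => (lo ≤ (i : ℕ) ∧ (i : ℕ) < hi) ∧
      ¬ (s ≤ (i : ℕ) ∧ (i : ℕ) < t)).card = (hi - lo) - (t - s) := by
  rw [← card_filter_fin_Ico h, ← card_filter_fin_Ico (N := N) (ht.trans h), Finset.filter_and_not,
    Finset.card_sdiff_of_subset]
  intro i hi
  simp only [Finset.mem_filter, Finset.mem_univ, true_and] at hi ⊢
  omega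

/-- Two equilibria of different welfare, when both facilities have enough agents on their outer side. -/
theorem exists_nash_ne_of_both_sides {n : ℕ} {q : Fin 2 → ℝ} {y : Fin 2 → ℝ} {a b : Fin 2}
    (hab : a ≠ b) (hya : y a = 2 / 5) (hyb : y b = 3 / 5) {w : ℕ}
    (ha : 1 ≤ capacity q (n + 1) a) (hb : 1 ≤ capacity q (n + 1) b)
    (hwa : capacity q (n + 1) a ≤ w) (hwb : w + capacity q (n + 1) b < n + 1) :
    ∃ x : Fin (n + 1) → ℝ, Monotone x ∧ (∀ i, x i ∈ Set.Icc (0 : ℝ) 1) ∧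
      (∀ i : Fin (n + 1), (i : ℕ) < w → w < i + capacity q (n + 1) a → x i = 2 / 5) ∧
      (∀ i : Fin (n + 1), w < i → i < w + capacity q (n + 1) b → x i = 3 / 5) ∧
      ∃ s t, IsNashEquilibrium q x y s ∧ IsNashEquilibrium q x y t ∧
        socialWelfare q x y s ≠ socialWelfare q x y t := by
  set ca := capacity q (n + 1) a with hca
  set cb := capacity q (n + 1) b with hcb
  -- Agent `w` at 1/2 is equidistant from both facilities. If it joins `a`, then `b` takes agent `w
  -- + cb` at 4/5, with utility 4/5. If it joins `b`, then `a` takes agent `w - ca` at 1/4, with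
  -- utility 17/20. The other utilities do not change.
  set X : ℕ → ℝ := fun t => if t < w - ca then 0 else
    if t < w - ca + 1 then 1 / 4 else
    if t < w then 2 / 5 else
    if t < w + 1 then 1 / 2 else
    if t < w + cb then 3 / 5 else
    if t < w + cb + 1 then 4 / 5 else
    1 with hX
  have hblock : ∀ t, (t < w - ca ∧ X t = 0) ∨
      (w - ca ≤ t ∧ t < w - ca + 1 ∧ X t = 1 / 4) ∨
      (w - ca + 1 ≤ t ∧ t < w ∧ X t = 2 / 5) ∨
      (w ≤ t ∧ t < w + 1 ∧ X t = 1 / 2) ∨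
      (w + 1 ≤ t ∧ t < w + cb ∧ X t = 3 / 5) ∨
      (w + cb ≤ t ∧ t < w + cb + 1 ∧ X t = 4 / 5) ∨
      (w + cb + 1 ≤ t ∧ X t = 1) := by
    intro t
    simp only [hX]
    split_ifs <;> simp <;> omega
  have hmem : ∀ t, X t ∈ Set.Icc (0 : ℝ) 1 := by
    intro t
    simp only [hX]
    split_ifs <;> constructor <;> norm_num
  have hmono : ∀ s t, s ≤ t → X s ≤ X t := by
    intro s t hst
    rcases hblock s with h | h | h | h | h | h | h <;>
    rcases hblock t with h' | h' | h' | h' | h' | h' | h' <;>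
    first | omega | (simp only [h, h']; norm_num)
  have hd : ∀ (i : Fin (n + 1)) (j : Fin 2), |X i - y j| ≤ 1 := by
    intro i j
    refine abs_sub_le_one_of_mem_Icc (hmem _) ?_
    rcases (by omega : j = a ∨ j = b) with rfl | rfl
    · rw [hya]; constructor <;> norm_num
    · rw [hyb]; constructor <;> norm_num
  obtain ⟨s, hs, hsw⟩ := exists_nash_of_full (q := q) (x := fun i : Fin (n + 1) => X i) (y := y)
    hab (fun i => w + 1 - ca ≤ (i : ℕ) ∧ (i : ℕ) < w + 1)
    (fun i => w + 1 ≤ (i : ℕ) ∧ (i : ℕ) < w + 1 + cb) (by intro i; omega)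
    (by rw [card_filter_fin_Ico (by omega)]; omega)
    (by rw [card_filter_fin_Ico (by omega)]; omega) hd
    (by
      intro i hi
      left
      rw [hya, hyb]
      rcases hblock i with h | h | h | h | h | h | h <;>
      first | omega | (simp only [h]; norm_num))
    (by
      intro i hi
      left
      rw [hya, hyb]
      rcases hblock i with h | h | h | h | h | h | h <;>
      first | omega | (simp only [h]; norm_num))
    (by
      intro i hi hi'
      rw [hya, hyb]
      constructor <;> intro k hk <;>
      rcases hblock i with h | h | h | h | h | h | h <;>
      first
        | omega
        | (rcases hblock k with h' | h' | h' | h' | h' | h' | h' <;>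
            first | omega | (simp only [h, h']; norm_num)))
  obtain ⟨t, ht, htw⟩ := exists_nash_of_full (q := q) (x := fun i : Fin (n + 1) => X i) (y := y)
    hab (fun i => w - ca ≤ (i : ℕ) ∧ (i : ℕ) < w)
    (fun i => w ≤ (i : ℕ) ∧ (i : ℕ) < w + cb) (by intro i; omega)
    (by rw [card_filter_fin_Ico (by omega)]; omega)
    (by rw [card_filter_fin_Ico (by omega)]; omega) hd
    (by
      intro i hi
      left
      rw [hya, hyb]
      rcases hblock i with h | h | h | h | h | h | h <;>
      first | omega | (simp only [h]; norm_num))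
    (by
      intro i hi
      left
      rw [hya, hyb]
      rcases hblock i with h | h | h | h | h | h | h <;>
      first | omega | (simp only [h]; norm_num))
    (by
      intro i hi hi'
      rw [hya, hyb]
      constructor <;> intro k hk <;>
      rcases hblock i with h | h | h | h | h | h | h <;>
      first
        | omega
        | (rcases hblock k with h' | h' | h' | h' | h' | h' | h' <;>
            first | omega | (simp only [h, h']; norm_num)))
  refine ⟨fun i => X i, fun i j hij => hmono _ _ hij, fun i => hmem i, ?_, ?_, s, t, hs, ht, ?_⟩
  · intro i h1 h2
    rcases hblock i with h | h | h | h | h | h | h <;> first | omega | (simp only [h])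
  · intro i h1 h2
    rcases hblock i with h | h | h | h | h | h | h <;> first | omega | (simp only [h])
  · rw [hsw, htw, hya, hyb]
    have hk : w + cb < n + 1 := hwb
    refine ne_of_lt ?_
    -- The accommodated sets differ only in `w - ca` and `w + cb`; exchanging these indices allows a
    -- termwise comparison.
    rw [← Equiv.sum_comp (Equiv.swap (⟨w - ca, by omega⟩ : Fin (n + 1)) ⟨w + cb, hk⟩)
      (fun i : Fin (n + 1) => if w - ca ≤ (i : ℕ) ∧ (i : ℕ) < w then 1 - |X i - 2 / 5| else
        if w ≤ (i : ℕ) ∧ (i : ℕ) < w + cb then 1 - |X i - 3 / 5| else 0)]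
    have hXk : X (w + cb) = 4 / 5 := by
      rcases hblock (w + cb) with h | h | h | h | h | h | h <;> first | omega | (simp only [h])
    have hXk' : X (w - ca) = 1 / 4 := by
      rcases hblock (w - ca) with h | h | h | h | h | h | h <;> first | omega | (simp only [h])
    have hXw : X w = 1 / 2 := by
      rcases hblock w with h | h | h | h | h | h | h <;> first | omega | (simp only [h])
    have hterm : ∀ i : Fin (n + 1), i ≠ ⟨w - ca, by omega⟩ → i ≠ ⟨w + cb, hk⟩ →
        (if w + 1 - ca ≤ (i : ℕ) ∧ (i : ℕ) < w + 1 then 1 - |X i - 2 / 5| else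
          if w + 1 ≤ (i : ℕ) ∧ (i : ℕ) < w + 1 + cb then 1 - |X i - 3 / 5| else 0) =
        (if w - ca ≤ (i : ℕ) ∧ (i : ℕ) < w then 1 - |X i - 2 / 5| else
          if w ≤ (i : ℕ) ∧ (i : ℕ) < w + cb then 1 - |X i - 3 / 5| else 0) := by
      intro i h1 h2
      have h1' : (i : ℕ) ≠ w - ca := fun h => h1 (Fin.ext h)
      have h2' : (i : ℕ) ≠ w + cb := fun h => h2 (Fin.ext h)
      by_cases hiw : (i : ℕ) = w
      · rw [hiw, hXw, if_pos (by omega), if_neg (by omega), if_pos (by omega)]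
        norm_num
      · split_ifs <;> first | rfl | omega
    refine Finset.sum_lt_sum (fun i _ => ?_) ⟨⟨w + cb, hk⟩, Finset.mem_univ _, ?_⟩
    · by_cases h1 : i = ⟨w - ca, by omega⟩
      · rw [h1, Equiv.swap_apply_left]
        simp only
        rw [if_neg (by omega), if_neg (by omega), if_neg (by omega), if_neg (by omega)]
      by_cases h2 : i = ⟨w + cb, hk⟩
      · rw [h2, Equiv.swap_apply_right]
        simp only
        rw [if_neg (by omega), if_pos (by omega), if_pos (by omega), hXk, hXk']
        norm_num
      rw [Equiv.swap_apply_of_ne_of_ne h1 h2, hterm i h1 h2]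
    · rw [Equiv.swap_apply_right]
      simp only
      rw [if_neg (by omega), if_pos (by omega), if_pos (by omega), hXk, hXk']
      norm_num

/-- Two equilibria of different welfare, when facility `a` has to accommodate agents beyond `b`. -/
theorem exists_nash_ne_of_overflow_right {n : ℕ} {q : Fin 2 → ℝ} {y : Fin 2 → ℝ} {a b : Fin 2}
    (hab : a ≠ b) (hya : y a = 2 / 5) (hyb : y b = 3 / 5) {w : ℕ}
    (ha : 1 ≤ capacity q (n + 1) a) (hb : 1 ≤ capacity q (n + 1) b)
    (hwa : w < capacity q (n + 1) a)
    (hn : capacity q (n + 1) a + capacity q (n + 1) b < n + 1) :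
    ∃ x : Fin (n + 1) → ℝ, Monotone x ∧ (∀ i, x i ∈ Set.Icc (0 : ℝ) 1) ∧
      (∀ i : Fin (n + 1), (i : ℕ) < w → w < i + capacity q (n + 1) a → x i = 2 / 5) ∧
      (∀ i : Fin (n + 1), w < i → i < w + capacity q (n + 1) b → x i = 3 / 5) ∧
      ∃ s t, IsNashEquilibrium q x y s ∧ IsNashEquilibrium q x y t ∧
        socialWelfare q x y s ≠ socialWelfare q x y t := by
  set ca := capacity q (n + 1) a with hca
  set cb := capacity q (n + 1) b with hcb
  -- Fewer than `ca` agents precede agent `w`, so `a` also takes agents beyond `b`, and both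
  -- equilibria accommodate the first `ca + cb` agents. If agent `w` at 1/2 joins `b`, it pushes
  -- agent `w + cb` at 4/5 from `b` to `a`, from distance 1/5 to distance 2/5.
  set X : ℕ → ℝ := fun t => if t < w then 2 / 5 else
    if t < w + 1 then 1 / 2 else
    if t < w + cb then 3 / 5 else
    if t < w + cb + 1 then 4 / 5 else
    if t < ca + cb then 17 / 20 else
    9 / 10 with hX
  have hblock : ∀ t, (t < w ∧ X t = 2 / 5) ∨
      (w ≤ t ∧ t < w + 1 ∧ X t = 1 / 2) ∨
      (w + 1 ≤ t ∧ t < w + cb ∧ X t = 3 / 5) ∨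
      (w + cb ≤ t ∧ t < w + cb + 1 ∧ X t = 4 / 5) ∨
      (w + cb + 1 ≤ t ∧ t < ca + cb ∧ X t = 17 / 20) ∨
      (ca + cb ≤ t ∧ X t = 9 / 10) := by
    intro t
    simp only [hX]
    split_ifs <;> simp <;> omega
  have hmem : ∀ t, X t ∈ Set.Icc (0 : ℝ) 1 := by
    intro t
    simp only [hX]
    split_ifs <;> constructor <;> norm_num
  have hmono : ∀ s t, s ≤ t → X s ≤ X t := by
    intro s t hst
    rcases hblock s with h | h | h | h | h | h <;>
    rcases hblock t with h' | h' | h' | h' | h' | h' <;>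
    first | omega | (simp only [h, h']; norm_num)
  have hd : ∀ (i : Fin (n + 1)) (j : Fin 2), |X i - y j| ≤ 1 := by
    intro i j
    refine abs_sub_le_one_of_mem_Icc (hmem _) ?_
    rcases (by omega : j = a ∨ j = b) with rfl | rfl
    · rw [hya]; constructor <;> norm_num
    · rw [hyb]; constructor <;> norm_num
  obtain ⟨s, hs, hsw⟩ := exists_nash_of_full (q := q) (x := fun i : Fin (n + 1) => X i) (y := y)
    hab (fun i => (0 ≤ (i : ℕ) ∧ (i : ℕ) < ca + cb) ∧ ¬ (w + 1 ≤ (i : ℕ) ∧ (i : ℕ) < w + 1 + cb))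
    (fun i => w + 1 ≤ (i : ℕ) ∧ (i : ℕ) < w + 1 + cb) (by intro i; omega)
    (by rw [card_filter_fin_Ico_sdiff (by omega) (by omega) (by omega)]; omega)
    (by rw [card_filter_fin_Ico (by omega)]; omega) hd
    (by
      intro i hi
      rw [hya, hyb]
      rcases hblock i with h | h | h | h | h | h <;>
      first
        | omega
        | (left; simp only [h]; norm_num; done)
        | (right; intro k hk; rcases hblock k with h' | h' | h' | h' | h' | h' <;>
            first | omega | (simp only [h, h']; norm_num)))
    (by
      intro i hi
      left
      rw [hya, hyb]
      rcases hblock i with h | h | h | h | h | h <;>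
      first | omega | (simp only [h]; norm_num))
    (by
      intro i hi hi'
      rw [hya, hyb]
      constructor <;> intro k hk <;>
      rcases hblock i with h | h | h | h | h | h <;>
      first
        | omega
        | (rcases hblock k with h' | h' | h' | h' | h' | h' <;>
            first | omega | (simp only [h, h']; norm_num)))
  obtain ⟨t, ht, htw⟩ := exists_nash_of_full (q := q) (x := fun i : Fin (n + 1) => X i) (y := y)
    hab (fun i => (0 ≤ (i : ℕ) ∧ (i : ℕ) < ca + cb) ∧ ¬ (w ≤ (i : ℕ) ∧ (i : ℕ) < w + cb))
    (fun i => w ≤ (i : ℕ) ∧ (i : ℕ) < w + cb) (by intro i; omega)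
    (by rw [card_filter_fin_Ico_sdiff (by omega) (by omega) (by omega)]; omega)
    (by rw [card_filter_fin_Ico (by omega)]; omega) hd
    (by
      intro i hi
      rw [hya, hyb]
      rcases hblock i with h | h | h | h | h | h <;>
      first
        | omega
        | (left; simp only [h]; norm_num; done)
        | (right; intro k hk; rcases hblock k with h' | h' | h' | h' | h' | h' <;>
            first | omega | (simp only [h, h']; norm_num)))
    (by
      intro i hi
      left
      rw [hya, hyb]
      rcases hblock i with h | h | h | h | h | h <;>
      first | omega | (simp only [h]; norm_num))
    (by
      intro i hi hi'
      rw [hya, hyb]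
      constructor <;> intro k hk <;>
      rcases hblock i with h | h | h | h | h | h <;>
      first
        | omega
        | (rcases hblock k with h' | h' | h' | h' | h' | h' <;>
            first | omega | (simp only [h, h']; norm_num)))
  refine ⟨fun i => X i, fun i j hij => hmono _ _ hij, fun i => hmem i, ?_, ?_, s, t, hs, ht, ?_⟩
  · intro i h1 h2
    rcases hblock i with h | h | h | h | h | h <;> first | omega | (simp only [h])
  · intro i h1 h2
    rcases hblock i with h | h | h | h | h | h <;> first | omega | (simp only [h])
  · rw [hsw, htw, hya, hyb]
    refine ne_of_gt ?_
    refine Finset.sum_lt_sum (fun i _ => ?_) ⟨⟨w + cb, by omega⟩, Finset.mem_univ _, ?_⟩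
    · rcases hblock i with h | h | h | h | h | h <;>
      split_ifs <;> first | omega | exact le_rfl | (simp only [h]; norm_num)
    · have hXk := hblock (w + cb)
      simp only
      rcases hXk with h | h | h | h | h | h <;>
      split_ifs <;> first | omega | (simp only [h]; norm_num)

/-- Two equilibria of different welfare, when facility `b` has to accommodate agents beyond `a`. -/
theorem exists_nash_ne_of_overflow_left {n : ℕ} {q : Fin 2 → ℝ} {y : Fin 2 → ℝ} {a b : Fin 2}
    (hab : a ≠ b) (hya : y a = 2 / 5) (hyb : y b = 3 / 5) {w : ℕ}
    (ha : 1 ≤ capacity q (n + 1) a) (hb : 1 ≤ capacity q (n + 1) b)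
    (hwb : n + 1 ≤ w + capacity q (n + 1) b) (hwn : w < n + 1)
    (hn : capacity q (n + 1) a + capacity q (n + 1) b < n + 1) :
    ∃ x : Fin (n + 1) → ℝ, Monotone x ∧ (∀ i, x i ∈ Set.Icc (0 : ℝ) 1) ∧
      (∀ i : Fin (n + 1), (i : ℕ) < w → w < i + capacity q (n + 1) a → x i = 2 / 5) ∧
      (∀ i : Fin (n + 1), w < i → i < w + capacity q (n + 1) b → x i = 3 / 5) ∧
      ∃ s t, IsNashEquilibrium q x y s ∧ IsNashEquilibrium q x y t ∧
        socialWelfare q x y s ≠ socialWelfare q x y t := by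
  set ca := capacity q (n + 1) a with hca
  set cb := capacity q (n + 1) b with hcb
  -- The mirror image: both equilibria accommodate the last `ca + cb` agents, and agent `w` at 1/2,
  -- by joining `a`, pushes agent `w - ca` at 1/5 from `a` to `b`.
  set X : ℕ → ℝ := fun t => if t < n + 1 - ca - cb then 1 / 10 else
    if t < w - ca then 3 / 20 else
    if t < w - ca + 1 then 1 / 5 else
    if t < w then 2 / 5 else
    if t < w + 1 then 1 / 2 else
    3 / 5 with hX
  have hblock : ∀ t, (t < n + 1 - ca - cb ∧ X t = 1 / 10) ∨
      (n + 1 - ca - cb ≤ t ∧ t < w - ca ∧ X t = 3 / 20) ∨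
      (w - ca ≤ t ∧ t < w - ca + 1 ∧ X t = 1 / 5) ∨
      (w - ca + 1 ≤ t ∧ t < w ∧ X t = 2 / 5) ∨
      (w ≤ t ∧ t < w + 1 ∧ X t = 1 / 2) ∨
      (w + 1 ≤ t ∧ X t = 3 / 5) := by
    intro t
    simp only [hX]
    split_ifs <;> simp <;> omega
  have hmem : ∀ t, X t ∈ Set.Icc (0 : ℝ) 1 := by
    intro t
    simp only [hX]
    split_ifs <;> constructor <;> norm_num
  have hmono : ∀ s t, s ≤ t → X s ≤ X t := by
    intro s t hst
    rcases hblock s with h | h | h | h | h | h <;>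
    rcases hblock t with h' | h' | h' | h' | h' | h' <;>
    first | omega | (simp only [h, h']; norm_num)
  have hd : ∀ (i : Fin (n + 1)) (j : Fin 2), |X i - y j| ≤ 1 := by
    intro i j
    refine abs_sub_le_one_of_mem_Icc (hmem _) ?_
    rcases (by omega : j = a ∨ j = b) with rfl | rfl
    · rw [hya]; constructor <;> norm_num
    · rw [hyb]; constructor <;> norm_num
  obtain ⟨s, hs, hsw⟩ := exists_nash_of_full (q := q) (x := fun i : Fin (n + 1) => X i) (y := y)
    hab (fun i => w + 1 - ca ≤ (i : ℕ) ∧ (i : ℕ) < w + 1)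
    (fun i => (n + 1 - ca - cb ≤ (i : ℕ) ∧ (i : ℕ) < n + 1) ∧ ¬ (w + 1 - ca ≤ (i : ℕ) ∧ (i : ℕ) < w + 1)) (by intro i; omega)
    (by rw [card_filter_fin_Ico (by omega)]; omega)
    (by rw [card_filter_fin_Ico_sdiff (by omega) (by omega) (by omega)]; omega) hd
    (by
      intro i hi
      left
      rw [hya, hyb]
      rcases hblock i with h | h | h | h | h | h <;>
      first | omega | (simp only [h]; norm_num))
    (by
      intro i hi
      rw [hya, hyb]
      rcases hblock i with h | h | h | h | h | h <;>
      first
        | omega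
        | (left; simp only [h]; norm_num; done)
        | (right; intro k hk; rcases hblock k with h' | h' | h' | h' | h' | h' <;>
            first | omega | (simp only [h, h']; norm_num)))
    (by
      intro i hi hi'
      rw [hya, hyb]
      constructor <;> intro k hk <;>
      rcases hblock i with h | h | h | h | h | h <;>
      first
        | omega
        | (rcases hblock k with h' | h' | h' | h' | h' | h' <;>
            first | omega | (simp only [h, h']; norm_num)))
  obtain ⟨t, ht, htw⟩ := exists_nash_of_full (q := q) (x := fun i : Fin (n + 1) => X i) (y := y)
    hab (fun i => w - ca ≤ (i : ℕ) ∧ (i : ℕ) < w)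
    (fun i => (n + 1 - ca - cb ≤ (i : ℕ) ∧ (i : ℕ) < n + 1) ∧ ¬ (w - ca ≤ (i : ℕ) ∧ (i : ℕ) < w)) (by intro i; omega)
    (by rw [card_filter_fin_Ico (by omega)]; omega)
    (by rw [card_filter_fin_Ico_sdiff (by omega) (by omega) (by omega)]; omega) hd
    (by
      intro i hi
      left
      rw [hya, hyb]
      rcases hblock i with h | h | h | h | h | h <;>
      first | omega | (simp only [h]; norm_num))
    (by
      intro i hi
      rw [hya, hyb]
      rcases hblock i with h | h | h | h | h | h <;>
      first
        | omega
        | (left; simp only [h]; norm_num; done)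
        | (right; intro k hk; rcases hblock k with h' | h' | h' | h' | h' | h' <;>
            first | omega | (simp only [h, h']; norm_num)))
    (by
      intro i hi hi'
      rw [hya, hyb]
      constructor <;> intro k hk <;>
      rcases hblock i with h | h | h | h | h | h <;>
      first
        | omega
        | (rcases hblock k with h' | h' | h' | h' | h' | h' <;>
            first | omega | (simp only [h, h']; norm_num)))
  refine ⟨fun i => X i, fun i j hij => hmono _ _ hij, fun i => hmem i, ?_, ?_, s, t, hs, ht, ?_⟩
  · intro i h1 h2
    rcases hblock i with h | h | h | h | h | h <;> first | omega | (simp only [h])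
  · intro i h1 h2
    rcases hblock i with h | h | h | h | h | h <;> first | omega | (simp only [h])
  · rw [hsw, htw, hya, hyb]
    refine ne_of_lt ?_
    refine Finset.sum_lt_sum (fun i _ => ?_) ⟨⟨w - ca, by omega⟩, Finset.mem_univ _, ?_⟩
    · rcases hblock i with h | h | h | h | h | h <;>
      split_ifs <;> first | omega | exact le_rfl | (simp only [h]; norm_num)
    · have hXk := hblock (w - ca)
      simp only
      rcases hXk with h | h | h | h | h | h <;>
      split_ifs <;> first | omega | (simp only [h]; norm_num)

/-! ### Capacities and percentiles -/

theorem capacity_le {m : ℕ} {q : Fin m → ℝ} (hq : ∀ j, 0 < q j) (n : ℕ) (j : Fin m) :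
    (capacity q n j : ℝ) ≤ q j * n :=
  Nat.floor_le (mul_nonneg (hq j).le (Nat.cast_nonneg n))

theorem lt_capacity_add_one {m : ℕ} (q : Fin m → ℝ) (n : ℕ) (j : Fin m) :
    q j * n < capacity q n j + 1 :=
  Nat.lt_floor_add_one _

theorem percentileRank_le (n : ℕ) (p : unitInterval) :
    ((percentileRank n p : ℕ) : ℝ) ≤ (p : ℝ) * n :=
  Nat.floor_le (mul_nonneg p.2.1 (Nat.cast_nonneg n))

theorem lt_percentileRank_add_one (n : ℕ) (p : unitInterval) :
    (p : ℝ) * n < ((percentileRank n p : ℕ) : ℝ) + 1 :=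
  Nat.lt_floor_add_one _

theorem percentileMechanism_of_monotone {n m : ℕ} (p : Fin m → unitInterval)
    {x : Fin (n + 1) → ℝ} (hx : Monotone x) (j : Fin m) :
    percentileMechanism p x j = x (percentileRank n (p j)) := by
  unfold percentileMechanism
  rw [Tuple.sort_eq_refl_iff_monotone.mpr hx]
  rfl

theorem add_eq_of_ne_fin_two {M : Type*} [AddCommMonoid M] (q : Fin 2 → M) {a b : Fin 2}
    (hab : a ≠ b) : q a + q b = q 0 + q 1 := by
  rcases (by omega : (a = 0 ∧ b = 1) ∨ (a = 1 ∧ b = 0)) with ⟨rfl, rfl⟩ | ⟨rfl, rfl⟩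
  · rfl
  · exact add_comm _ _

/-- In an Equilibrium Stable percentile mechanism, facilities at different percentiles have enough
agents between them to fill both. -/
theorem IsEquilibriumStable.add_le_sub {q : Fin 2 → ℝ} (hq : ∀ j, 0 < q j) (hq1 : q 0 + q 1 < 1)
    {p : Fin 2 → unitInterval} (hES : IsEquilibriumStable q p) {a b : Fin 2} (hab : a ≠ b)
    (hp : (p a : ℝ) < p b) : q a + q b ≤ (p b : ℝ) - p a := by
  by_contra! hlt
  have hg : 0 < (p b : ℝ) - p a := sub_pos.mpr hp
  have hg' : 0 < q a + q b - ((p b : ℝ) - p a) := sub_pos.mpr hlt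
  have hsum : q a + q b < 1 := by rwa [add_eq_of_ne_fin_two q hab]
  -- The numerators absorb the floors in the ranks and capacities, leaving the integer slack
  -- recorded in `i1` to `i4`.
  obtain ⟨n, hn⟩ := exists_nat_ge (3 / ((p b : ℝ) - p a) + 5 / (q a + q b - ((p b : ℝ) - p a)) +
    3 / q a + 3 / q b)
  have ha := hq a
  have hb := hq b
  have e1 : 0 < 3 / ((p b : ℝ) - p a) := by positivity
  have e2 : 0 < 5 / (q a + q b - ((p b : ℝ) - p a)) := by positivity
  have e3 : 0 < 3 / q a := by positivity
  have e4 : 0 < 3 / q b := by positivity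
  have n1 : 3 ≤ n * ((p b : ℝ) - p a) := (div_le_iff₀ hg).mp (by linarith)
  have n2 : 5 ≤ n * (q a + q b - ((p b : ℝ) - p a)) := (div_le_iff₀ hg').mp (by linarith)
  have n3 : 3 ≤ n * q a := (div_le_iff₀ ha).mp (by linarith)
  have n4 : 3 ≤ n * q b := (div_le_iff₀ hb).mp (by linarith)
  have ca1 := capacity_le hq (n + 1) a
  have cb1 := capacity_le hq (n + 1) b
  have ca2 := lt_capacity_add_one q (n + 1) a
  have cb2 := lt_capacity_add_one q (n + 1) b
  have ra1 := percentileRank_le n (p a)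
  have rb1 := percentileRank_le n (p b)
  have ra2 := lt_percentileRank_add_one n (p a)
  have rb2 := lt_percentileRank_add_one n (p b)
  have rbn := (percentileRank n (p b)).isLt
  push_cast at ca1 cb1 ca2 cb2
  generalize hca : capacity q (n + 1) a = ca at *
  generalize hcb : capacity q (n + 1) b = cb at *
  generalize hra : (percentileRank n (p a) : ℕ) = ra at *
  generalize hrb : (percentileRank n (p b) : ℕ) = rb at *
  have i1 : ra + 2 ≤ rb := by
    have : (ra : ℝ) + 2 < rb + 1 := by linarith
    exact_mod_cast Nat.lt_succ_iff.mp (by exact_mod_cast this)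
  have i2 : rb + 2 ≤ ra + ca + cb := by
    have : (rb : ℝ) + 2 < ra + ca + cb + 1 := by linarith
    exact_mod_cast Nat.lt_succ_iff.mp (by exact_mod_cast this)
  have i3 : 2 ≤ ca := by
    have : (2 : ℝ) < ca + 1 := by linarith
    exact_mod_cast Nat.lt_succ_iff.mp (by exact_mod_cast this)
  have i4 : 2 ≤ cb := by
    have : (2 : ℝ) < cb + 1 := by linarith
    exact_mod_cast Nat.lt_succ_iff.mp (by exact_mod_cast this)
  have i5 : ca + cb < n + 1 := by
    have h0 : (0 : ℝ) < (n : ℝ) + 1 := by positivity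
    have : (ca : ℝ) + cb < n + 1 := by
      have := mul_lt_mul_of_pos_right hsum h0
      linarith
    exact_mod_cast this
  -- `w` is the rank of the indifferent agent. The constructed inputs put 2/5 at the `ca - 1` ranks
  -- just below `w`, as far as these exist, and 3/5 at the `cb - 1` just above, so the mechanism
  -- places its facilities there. The witness is the smallest admissible `w`.
  obtain ⟨w, w1, w2, w3, w4⟩ : ∃ w, ra < w ∧ w < rb ∧ w < ra + ca ∧ rb < w + cb :=
    ⟨max (ra + 1) (rb + 1 - cb), by omega, by omega, by omega, by omega⟩
  set y : Fin 2 → ℝ := fun j => if j = a then 2 / 5 else 3 / 5 with hy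
  have hya : y a = 2 / 5 := by simp [hy]
  have hyb : y b = 3 / 5 := by simp [hy, hab.symm]
  obtain ⟨x, hmono, hmem, hxa, hxb, s, t, hs, ht, hne⟩ : ∃ x : Fin (n + 1) → ℝ, Monotone x ∧
      (∀ i, x i ∈ Set.Icc (0 : ℝ) 1) ∧
      (∀ i : Fin (n + 1), (i : ℕ) < w → w < i + capacity q (n + 1) a → x i = 2 / 5) ∧
      (∀ i : Fin (n + 1), w < i → i < w + capacity q (n + 1) b → x i = 3 / 5) ∧
      ∃ s t, IsNashEquilibrium q x y s ∧ IsNashEquilibrium q x y t ∧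
        socialWelfare q x y s ≠ socialWelfare q x y t := by
    by_cases h1 : w < ca
    · exact exists_nash_ne_of_overflow_right hab hya hyb (by omega) (by omega) (by omega)
        (by omega)
    by_cases h2 : n + 1 ≤ w + cb
    · exact exists_nash_ne_of_overflow_left hab hya hyb (by omega) (by omega) (by omega)
        (by omega) (by omega)
    · exact exists_nash_ne_of_both_sides hab hya hyb (by omega) (by omega) (by omega) (by omega)
  have hyeq : percentileMechanism p x = y := by
    funext j
    rw [percentileMechanism_of_monotone p hmono]
    rcases (by omega : j = a ∨ j = b) with rfl | rfl
    · rw [hya]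
      exact hxa _ (by omega) (by omega)
    · rw [hyb]
      exact hxb _ (by omega) (by omega)
  have := hES n x hmem s t
  rw [hyeq] at this
  exact hne (this hs ht)

/-! ### Numbers of agents below, above and between order statistics. -/

open Classical in
theorem card_lt_sort_le {n : ℕ} (x : Fin n → ℝ) (r : Fin n) :
    (Finset.univ.filter fun l => x l < x (Tuple.sort x r)).card ≤ r := by
  rw [← Fin.card_Iio r]
  refine Finset.card_le_card_of_injOn (Tuple.sort x).symm ?_ (Equiv.injective _).injOn
  intro l hl
  simp only [Finset.coe_filter, Finset.mem_univ, true_and, Set.mem_ofPred_eq] at hl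
  simp only [Finset.coe_Iio, Set.mem_Iio]
  by_contra! h
  have := Tuple.monotone_sort x h
  simp only [Function.comp_apply, Equiv.apply_symm_apply] at this
  linarith

open Classical in
theorem card_sort_lt_le {n : ℕ} (x : Fin n → ℝ) (r : Fin n) :
    (Finset.univ.filter fun l => x (Tuple.sort x r) < x l).card ≤ n - 1 - r := by
  rw [← Fin.card_Ioi r]
  refine Finset.card_le_card_of_injOn (Tuple.sort x).symm ?_ (Equiv.injective _).injOn
  intro l hl
  simp only [Finset.coe_filter, Finset.mem_univ, true_and, Set.mem_ofPred_eq] at hl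
  simp only [Finset.coe_Ioi, Set.mem_Ioi]
  by_contra! h
  have := Tuple.monotone_sort x h
  simp only [Function.comp_apply, Equiv.apply_symm_apply] at this
  linarith

theorem le_card_between_sort {n : ℕ} (x : Fin n → ℝ) (r s : Fin n) :
    (s : ℕ) + 1 - r ≤ (Finset.univ.filter fun l =>
      x (Tuple.sort x r) ≤ x l ∧ x l ≤ x (Tuple.sort x s)).card := by
  rw [← Fin.card_Icc r s]
  refine Finset.card_le_card_of_injOn (Tuple.sort x) ?_ (Equiv.injective _).injOn
  intro l hl
  rw [Finset.coe_Icc, Set.mem_Icc] at hl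
  simp only [Finset.coe_filter, Finset.mem_univ, true_and, Set.mem_ofPred_eq]
  exact ⟨Tuple.monotone_sort x hl.1, Tuple.monotone_sort x hl.2⟩

/-! ### The mechanism is beaten on typical inputs -/

/-- Agents' positions are typical at scale `δ`. -/
structure IsTypical {n : ℕ} (x : Fin n → ℝ) (δ K : ℝ) : Prop where
  mem_Icc : ∀ i, x i ∈ Set.Icc (0 : ℝ) 1
  injective : Function.Injective x
  isSpread : IsSpread x δ K

/-- On typical inputs the percentile mechanism loses at least `δ * κ` per agent. -/
def HasUniformGain (q : Fin 2 → ℝ) (p : Fin 2 → unitInterval) : Prop :=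
  ∃ κ > 0, ∃ η > 0, ∀ δ > 0, ∃ n₀ : ℕ, ∀ n ≥ n₀, ∀ x : Fin (n + 1) → ℝ,
    IsTypical x δ (η * (n + 1)) → ∀ s,
      socialWelfare q x (percentileMechanism p x) s + δ * κ * (n + 1) ≤ optimalWelfare q x

theorem hasUniformGain_of_eq {q : Fin 2 → ℝ} (hq : ∀ j, 0 < q j) (hq1 : q 0 + q 1 < 1)
    {p : Fin 2 → unitInterval} (hp : p 0 = p 1) : HasUniformGain q p := by
  set m := min (q 0) (q 1) with hm
  have hm0 : 0 < m := lt_min (hq 0) (hq 1)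
  have hmq : ∀ j, m ≤ q j := by
    rw [Fin.forall_fin_two]
    exact ⟨min_le_left _ _, min_le_right _ _⟩
  -- The gain per δ is C - 11K with C = m(n + 1) - 1. The choice 1/44 makes 11K a quarter of m(n +
  -- 1), and the rounding term 1 is at most another quarter, which leaves m / 2.
  refine ⟨m / 2, by positivity, m / 44, by positivity, fun δ hδ => ?_⟩
  obtain ⟨n₀, hn₀⟩ := exists_nat_ge (4 / m)
  refine ⟨n₀, fun n hn x hx s => ?_⟩
  have hnm : 4 ≤ n * m := (div_le_iff₀ hm0).mp (hn₀.trans (by exact_mod_cast hn))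
  set u := percentileMechanism p x 0 with hu
  have hyu : ∀ j, percentileMechanism p x j = u := by
    rw [Fin.forall_fin_two]
    refine ⟨rfl, ?_⟩
    simp only [hu, percentileMechanism, hp]
  have humem : u ∈ Set.Icc (0 : ℝ) 1 := hx.mem_Icc _
  have hsum : ∑ j, capacity q (n + 1) j ≤ n + 1 := by
    have h0 := capacity_le hq (n + 1) 0
    have h1 := capacity_le hq (n + 1) 1
    push_cast at h0 h1
    have h2 := mul_lt_mul_of_pos_right hq1 (by positivity : (0 : ℝ) < n + 1)
    rw [Fin.sum_univ_two]
    have : (capacity q (n + 1) 0 : ℝ) + capacity q (n + 1) 1 ≤ n + 1 := by linarith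
    exact_mod_cast this
  obtain ⟨T, hTc, hT⟩ := exists_isClosestSet x u hsum
  have hsw := socialWelfare_const_le hyu s hT hTc
    (fun i => abs_sub_le_one_of_mem_Icc (hx.mem_Icc i) humem)
  obtain ⟨y, hy, f, hf, hgain⟩ := exists_stable_gain_of_common (capacity q (n + 1)) (C := m * (n + 1) - 1)
    hδ hx.mem_Icc humem hTc hT hx.isSpread (fun j => by
      have h1 := lt_capacity_add_one q (n + 1) j
      push_cast at h1
      have h2 := mul_le_mul_of_nonneg_right (hmq j) (by positivity : (0 : ℝ) ≤ n + 1)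
      linarith) (by nlinarith)
  refine le_trans ?_ (hgain.trans (hf.matchingWelfare_le hx.mem_Icc hy))
  have : δ * (m / 2) * (n + 1) ≤ δ * (m * (n + 1) - 1 - 11 * (m / 44 * (n + 1))) := by
    rw [mul_assoc]
    gcongr
    nlinarith
  linarith

theorem hasUniformGain_of_apart {q : Fin 2 → ℝ} (hq : ∀ j, 0 < q j) (hq1 : q 0 + q 1 < 1)
    (hq2 : 2 / 3 < q 0 + q 1) {p : Fin 2 → unitInterval} {a b : Fin 2} (hab : a ≠ b)
    (hp : q a + q b ≤ (p b : ℝ) - p a) : HasUniformGain q p := by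
  have hqab := add_eq_of_ne_fin_two q hab
  set m := min (q 0) (q 1) with hm
  have hm0 : 0 < m := lt_min (hq 0) (hq 1)
  have hmq : ∀ j, m ≤ q j := by
    rw [Fin.forall_fin_two]
    exact ⟨min_le_left _ _, min_le_right _ _⟩
  -- If neither quantity were positive, then q a + q b ≤ 2(1 - (p b - p a)) ≤ 2(1 - (q a + q b)),
  -- contradicting q a + q b > 2/3. A positive one says that the agents on the outer side of that
  -- facility number less than half its capacity, asymptotically.
  obtain ⟨κ, hκ, hside⟩ : ∃ κ > 0, κ ≤ q a - 2 * p a ∨ κ ≤ q b - 2 * (1 - (p b : ℝ)) := by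
    by_cases h : 0 < q a - 2 * p a
    · exact ⟨_, h, Or.inl le_rfl⟩
    · exact ⟨q b - 2 * (1 - (p b : ℝ)), by linarith, Or.inr le_rfl⟩
  refine ⟨κ / 2, by positivity, min (κ / 8) (m / 2), by positivity, fun δ hδ => ?_⟩
  obtain ⟨n₀, hn₀⟩ := exists_nat_ge (12 / κ + 2 / m)
  refine ⟨n₀, fun n hn x hx s => ?_⟩
  have hnn : 12 / κ + 2 / m ≤ n := hn₀.trans (by exact_mod_cast hn)
  have e1 : 0 < 12 / κ := by positivity
  have e2 : 0 < 2 / m := by positivity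
  have hnκ : 12 ≤ n * κ := (div_le_iff₀ hκ).mp (by linarith)
  have hnm : 2 ≤ n * m := (div_le_iff₀ hm0).mp (by linarith)
  have hN : (0 : ℝ) < n + 1 := by positivity
  set K := min (κ / 8) (m / 2) * ((n : ℝ) + 1) with hKdef
  have hK1 : K ≤ κ / 8 * (n + 1) := mul_le_mul_of_nonneg_right (min_le_left _ _) hN.le
  have hK2 : K ≤ m / 2 * (n + 1) := mul_le_mul_of_nonneg_right (min_le_right _ _) hN.le
  set g : Fin 2 → Fin (n + 1) := fun j => Tuple.sort x (percentileRank n (p j)) with hg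
  have hyg : percentileMechanism p x = fun j => x (g j) := rfl
  have hcn : ∀ j, capacity q (n + 1) j ≤ n + 1 := by
    have h0 := capacity_le hq (n + 1)
    push_cast at h0
    have : ∀ j, q j ≤ 1 := by
      rw [Fin.forall_fin_two]
      constructor <;> linarith [hq 0, hq 1]
    intro j
    have h2 : (capacity q (n + 1) j : ℝ) ≤ n + 1 :=
      (h0 j).trans (mul_le_of_le_one_left hN.le (this j))
    exact_mod_cast h2
  choose T hTc hT using fun j => exists_isClosestSet x (x (g j)) (hcn j)
  have hsw := socialWelfare_le_sum_isClosestSet (q := q) (y := percentileMechanism p x) s hT hTc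
    (fun i j => abs_sub_le_one_of_mem_Icc (hx.mem_Icc i) (hx.mem_Icc _))
  have hcap : ∀ j, K < capacity q (n + 1) j := by
    intro j
    have h1 := lt_capacity_add_one q (n + 1) j
    push_cast at h1
    have h2 := mul_le_mul_of_nonneg_right (hmq j) hN.le
    nlinarith
  have ra1 := percentileRank_le n (p a)
  have rb2 := lt_percentileRank_add_one n (p b)
  -- Capacities scale with n + 1 but ranks with n, which costs q a + q b < 1; the floor in the rank
  -- of `b` costs less than 1. Counting both end agents makes up for this.
  have hbet : capacity q (n + 1) a + capacity q (n + 1) b ≤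
      (Finset.univ.filter fun l => x (g a) ≤ x l ∧ x l ≤ x (g b)).card := by
    refine le_trans ?_ (le_card_between_sort x (percentileRank n (p a)) (percentileRank n (p b)))
    have h1 := capacity_le hq (n + 1) a
    have h2 := capacity_le hq (n + 1) b
    push_cast at h1 h2
    have h3 := mul_le_mul_of_nonneg_right hp (Nat.cast_nonneg n : (0 : ℝ) ≤ n)
    have h4 : (capacity q (n + 1) a : ℝ) + capacity q (n + 1) b + (percentileRank n (p a) : ℕ) <
      (percentileRank n (p b) : ℕ) + 2 := by linarith
    have h5 : capacity q (n + 1) a + capacity q (n + 1) b + (percentileRank n (p a) : ℕ) <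
      (percentileRank n (p b) : ℕ) + 2 := by exact_mod_cast h4
    omega
  -- The facility `d` given by `hside` moves inward. Its rank bounds the outer agents of `T d`, at
  -- most `K` more are within δ of it, and all the others gain δ.
  obtain ⟨d, σ, hσ, hcount⟩ : ∃ (d : Fin 2) (σ : ℝ), (σ = 1 ∨ σ = -1) ∧
      κ / 2 * (n + 1) ≤ 2 * ((sideSet x (x (g d)) δ σ (T d)).card : ℝ) -
        capacity q (n + 1) d := by
    rcases hside with h | h
    · refine ⟨a, 1, Or.inl rfl, ?_⟩
      have h1 := hx.isSpread.card_le_add_sideSet (x (g a)) (Or.inl rfl : (1 : ℝ) = 1 ∨ _) (T a)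
      rw [hTc] at h1
      have h2 : ((sideSet x (x (g a)) δ (-1) (T a)).card : ℝ) ≤ (percentileRank n (p a) : ℕ) := by
        refine Nat.cast_le.mpr (le_trans (Finset.card_le_card fun l hl => ?_)
          (card_lt_sort_le x (percentileRank n (p a))))
        simp only [Finset.mem_filter, Finset.mem_univ, true_and]
        have := (mem_sideSet.mp hl).2
        linarith
      have h3 := lt_capacity_add_one q (n + 1) a
      push_cast at h3
      have h4 := mul_le_mul_of_nonneg_right h hN.le
      have h5 := (p a).2.1
      nlinarith
    · refine ⟨b, -1, Or.inr rfl, ?_⟩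
      have h1 := hx.isSpread.card_le_add_sideSet (x (g b)) (Or.inr rfl : _ ∨ (-1 : ℝ) = -1) (T b)
      rw [hTc, neg_neg] at h1
      have h2 : ((sideSet x (x (g b)) δ 1 (T b)).card : ℝ) ≤
          n - ((percentileRank n (p b) : ℕ) : ℝ) := by
        have hlt := (percentileRank n (p b)).isLt
        rw [← Nat.cast_sub (by omega)]
        refine Nat.cast_le.mpr (le_trans (Finset.card_le_card fun l hl => ?_)
          (card_sort_lt_le x (percentileRank n (p b))))
        simp only [Finset.mem_filter, Finset.mem_univ, true_and]
        have := (mem_sideSet.mp hl).2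
        linarith
      have h3 := lt_capacity_add_one q (n + 1) b
      push_cast at h3
      have h4 := mul_le_mul_of_nonneg_right h hN.le
      have h5 := (p b).2.2
      nlinarith
  obtain ⟨y, hy, f, hf, hgain⟩ := exists_stable_gain_of_apart (capacity q (n + 1)) (g := g)
    (d := d) hσ hδ hx.mem_Icc hx.injective hTc hx.isSpread hcap hcn hab hbet (by
      rw [← Finset.card_pos]
      have h1 : (0 : ℝ) ≤ capacity q (n + 1) d := Nat.cast_nonneg _
      have h2 : 0 < κ / 2 * ((n : ℝ) + 1) := by positivity
      have h3 : (0 : ℝ) < (sideSet x (x (g d)) δ σ (T d)).card := by linarith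
      exact_mod_cast h3)
  refine le_trans ?_ (hgain.trans (hf.matchingWelfare_le hx.mem_Icc hy))
  rw [mul_assoc]
  exact add_le_add hsw (mul_le_mul_of_nonneg_left hcount hδ.le)

theorem IsEquilibriumStable.hasUniformGain {q : Fin 2 → ℝ} (hq : ∀ j, 0 < q j)
    (hq1 : q 0 + q 1 < 1) (hq2 : 2 / 3 < q 0 + q 1) {p : Fin 2 → unitInterval}
    (hES : IsEquilibriumStable q p) : HasUniformGain q p := by
  rcases lt_trichotomy (p 0) (p 1) with h | h | h
  · exact hasUniformGain_of_apart hq hq1 hq2 (by decide) (hES.add_le_sub hq hq1 (by decide) h)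
  · exact hasUniformGain_of_eq hq hq1 h
  · exact hasUniformGain_of_apart hq hq1 hq2 (by decide) (hES.add_le_sub hq hq1 (by decide) h)

/-! ### Typical positions -/

/-- An absolutely continuous finite measure gives little mass to short intervals. -/
theorem exists_pos_measure_Icc_le (μ : Measure ℝ) [IsFiniteMeasure μ] (hac : μ ≪ volume)
    {ε : ENNReal} (hε : ε ≠ 0) : ∃ r > 0, ∀ t : ℝ, μ (Set.Icc (t - r) (t + r)) ≤ ε := by
  have hfin : ∫⁻ x, μ.rnDeriv volume x ∂volume ≠ ⊤ :=
    (Measure.lintegral_rnDeriv_lt_top μ volume).ne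
  obtain ⟨η, hη, h⟩ := exists_pos_setLIntegral_lt_of_measure_lt hfin hε
  obtain ⟨r, hr, hrη⟩ : ∃ r : ℝ, 0 < r ∧ ENNReal.ofReal (2 * r) < η := by
    rcases eq_or_ne η ⊤ with rfl | htop
    · exact ⟨1, one_pos, ENNReal.ofReal_lt_top⟩
    · have h0 := ENNReal.toReal_pos hη.ne' htop
      refine ⟨η.toReal / 4, by positivity, ?_⟩
      rw [← ENNReal.ofReal_toReal htop, ENNReal.ofReal_lt_ofReal_iff h0]
      simp only [ENNReal.toReal_ofReal h0.le]
      linarith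
  refine ⟨r, hr, fun t => ?_⟩
  have h1 := h (Set.Icc (t - r) (t + r)) (by
    rw [Real.volume_Icc]
    convert hrη using 2
    ring)
  rw [← Measure.withDensity_rnDeriv_eq μ volume hac, withDensity_apply _ measurableSet_Icc]
  simpa [Measure.withDensity_rnDeriv_eq μ volume hac] using h1.le

/-- By independence the two coordinates have joint law μ × μ, and for each value of one the other
must fall in an interval of radius `r`. -/
theorem measure_pi_dist_le {ι : Type*} [Fintype ι] (μ : Measure ℝ) [IsProbabilityMeasure μ]
    {r : ℝ} {ε : ENNReal} (h : ∀ t : ℝ, μ (Set.Icc (t - r) (t + r)) ≤ ε) {i j : ι} (hij : i ≠ j) :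
    Measure.pi (fun _ : ι => μ) {x | |x i - x j| ≤ r} ≤ ε := by
  have hind : ProbabilityTheory.IndepFun (fun x : ι → ℝ => x i) (fun x => x j)
      (Measure.pi fun _ => μ) :=
    (ProbabilityTheory.iIndepFun_pi (μ := fun _ : ι => μ) (X := fun _ => id)
      (fun _ => aemeasurable_id)).indepFun hij
  have hmap := (ProbabilityTheory.indepFun_iff_map_prod_eq_prod_map_map
    (measurable_pi_apply i).aemeasurable (measurable_pi_apply j).aemeasurable).mp hind
  have hi : (Measure.pi fun _ : ι => μ).map (fun x => x i) = μ :=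
    (measurePreserving_eval (fun _ : ι => μ) i).map_eq
  have hj : (Measure.pi fun _ : ι => μ).map (fun x => x j) = μ :=
    (measurePreserving_eval (fun _ : ι => μ) j).map_eq
  rw [hi, hj] at hmap
  have hs : MeasurableSet {z : ℝ × ℝ | |z.1 - z.2| ≤ r} :=
    measurableSet_le (by fun_prop) measurable_const
  have hpre : {x : ι → ℝ | |x i - x j| ≤ r} =
      (fun x : ι → ℝ => (x i, x j)) ⁻¹' {z : ℝ × ℝ | |z.1 - z.2| ≤ r} := rfl
  rw [hpre, ← Measure.map_apply (by fun_prop) hs, hmap, Measure.prod_apply hs]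
  calc ∫⁻ t, μ (Prod.mk t ⁻¹' {z : ℝ × ℝ | |z.1 - z.2| ≤ r}) ∂μ
      ≤ ∫⁻ _, ε ∂μ := by
        refine lintegral_mono fun t => le_trans (measure_mono fun z hz => ?_) (h t)
        have hz : |t - z| ≤ r := hz
        rw [abs_le] at hz
        constructor <;> linarith [hz.1, hz.2]
    _ = ε := by simp

theorem ae_pi_injective {ι : Type*} [Fintype ι] (μ : Measure ℝ) [IsProbabilityMeasure μ]
    [NullSingletonClass μ] : ∀ᵐ x ∂(Measure.pi fun _ : ι => μ), Function.Injective x := by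
  have h : ∀ i j : ι, ∀ᵐ x ∂(Measure.pi fun _ : ι => μ), i ≠ j → x i ≠ x j := by
    intro i j
    by_cases hij : i = j
    · exact Eventually.of_forall fun x hne => absurd hij hne
    · have h0 := measure_pi_dist_le μ (r := 0) (ε := 0) (fun t => by simp) hij
      rw [nonpos_iff_eq_zero] at h0
      rw [ae_iff]
      refine measure_mono_null (fun x hx => ?_) h0
      have hx : ¬ (i ≠ j → x i ≠ x j) := hx
      push Not at hx
      change |x i - x j| ≤ 0
      rw [hx.2, sub_self, abs_zero]
  have hall := ae_all_iff.mpr fun i => ae_all_iff.mpr fun j => h i j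
  filter_upwards [hall] with x hx i j hij
  by_contra hne
  exact hx i j hne hij

theorem ae_pi_mem_Icc {ι : Type*} [Fintype ι] (μ : Measure ℝ) [IsProbabilityMeasure μ]
    (hsupp : μ (Set.Icc (0 : ℝ) 1) = 1) :
    ∀ᵐ x ∂(Measure.pi fun _ : ι => μ), ∀ i, x i ∈ Set.Icc (0 : ℝ) 1 := by
  rw [ae_all_iff]
  intro i
  have h : ∀ᵐ z ∂μ, z ∈ Set.Icc (0 : ℝ) 1 := by
    rw [mem_ae_iff_prob_eq_one measurableSet_Icc |>.symm] at hsupp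
    exact hsupp
  exact (measurePreserving_eval (fun _ : ι => μ) i).quasiMeasurePreserving.ae h

/-! ### Second moment control of the agents in short windows. -/

/-- The number of ordered pairs of agents at distance at most `r`. -/
noncomputable def closePairs {n : ℕ} (r : ℝ) (x : Fin n → ℝ) : ℝ :=
  ∑ i, ∑ j, ({x | |x i - x j| ≤ r} : Set (Fin n → ℝ)).indicator 1 x

theorem measurableSet_dist_le {n : ℕ} (r : ℝ) (i j : Fin n) :
    MeasurableSet ({x | |x i - x j| ≤ r} : Set (Fin n → ℝ)) :=
  measurableSet_le (by fun_prop) measurable_const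

theorem closePairs_nonneg {n : ℕ} (r : ℝ) (x : Fin n → ℝ) : 0 ≤ closePairs r x :=
  Finset.sum_nonneg fun _ _ => Finset.sum_nonneg fun _ _ =>
    Set.indicator_nonneg (fun _ _ => zero_le_one) _

/-- Agents in one window of length 2δ form |A|² close ordered pairs, diagonal included. A single
integrable count thus controls all windows at once. -/
theorem isSpread_of_closePairs_le {n : ℕ} {x : Fin n → ℝ} {δ K : ℝ} (hK : 0 ≤ K)
    (h : closePairs (2 * δ) x ≤ K ^ 2) : IsSpread x δ K := by
  rintro A ⟨t, ht⟩
  refine le_of_sq_le_sq (le_trans ?_ h) hK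
  calc (A.card : ℝ) ^ 2 = ∑ i ∈ A, ∑ j ∈ A, 1 := by simp [sq]
    _ = ∑ i ∈ A, ∑ j ∈ A, ({x | |x i - x j| ≤ 2 * δ} : Set (Fin n → ℝ)).indicator 1 x := by
        refine Finset.sum_congr rfl fun i hi => Finset.sum_congr rfl fun j hj => ?_
        rw [Set.indicator_of_mem]
        · rfl
        · have h1 := ht i hi
          have h2 := ht j hj
          change |x i - x j| ≤ 2 * δ
          rw [abs_le]
          constructor <;> linarith [h1.1, h1.2, h2.1, h2.2]
    _ ≤ closePairs (2 * δ) x := by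
        have h0 : ∀ i j : Fin n,
            0 ≤ ({x | |x i - x j| ≤ 2 * δ} : Set (Fin n → ℝ)).indicator (1 : (Fin n → ℝ) → ℝ) x :=
          fun i j => Set.indicator_nonneg (fun _ _ => zero_le_one) _
        refine (Finset.sum_le_sum fun i _ => Finset.sum_le_sum_of_subset_of_nonneg
          (Finset.subset_univ A) fun j _ _ => h0 i j).trans ?_
        exact Finset.sum_le_sum_of_subset_of_nonneg (Finset.subset_univ A)
          fun i _ _ => Finset.sum_nonneg fun j _ => h0 i j

theorem integrable_closePairs {n : ℕ} (r : ℝ) (ν : Measure (Fin n → ℝ)) [IsFiniteMeasure ν] :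
    Integrable (closePairs r) ν := by
  unfold closePairs
  refine integrable_finsetSum _ fun i _ => integrable_finsetSum _ fun j _ => ?_
  exact (integrable_const (1 : ℝ)).indicator (measurableSet_dist_le r i j)

theorem integral_closePairs_le {n : ℕ} (μ : Measure ℝ) [IsProbabilityMeasure μ] {r ε : ℝ}
    (hε : 0 ≤ ε) (h : ∀ t : ℝ, μ (Set.Icc (t - r) (t + r)) ≤ ENNReal.ofReal ε) :
    ∫ x, closePairs r x ∂(Measure.pi fun _ : Fin n => μ) ≤ n + n ^ 2 * ε := by
  set ν := Measure.pi fun _ : Fin n => μ with hν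
  have hint : ∀ i j : Fin n, Integrable
      (({x | |x i - x j| ≤ r} : Set (Fin n → ℝ)).indicator (1 : (Fin n → ℝ) → ℝ)) ν :=
    fun i j => (integrable_const (1 : ℝ)).indicator (measurableSet_dist_le r i j)
  have hbound : ∀ i j : Fin n, ν.real {x | |x i - x j| ≤ r} ≤ (if i = j then 1 else 0) + ε := by
    intro i j
    split_ifs with hij
    · linarith [measureReal_le_one (μ := ν) (s := {x | |x i - x j| ≤ r})]
    · rw [zero_add]
      exact ENNReal.toReal_le_of_le_ofReal hε (measure_pi_dist_le μ h hij)
  unfold closePairs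
  rw [integral_finsetSum _ fun i _ => integrable_finsetSum _ fun j _ => hint i j]
  calc ∑ i, ∫ x, ∑ j, ({x | |x i - x j| ≤ r} : Set (Fin n → ℝ)).indicator (1 : (Fin n → ℝ) → ℝ) x ∂ν
      = ∑ i, ∑ j, ν.real {x | |x i - x j| ≤ r} := by
        refine Finset.sum_congr rfl fun i _ => ?_
        rw [integral_finsetSum _ fun j _ => hint i j]
        exact Finset.sum_congr rfl fun j _ => integral_indicator_one (measurableSet_dist_le r i j)
    _ ≤ ∑ i : Fin n, ∑ j : Fin n, ((if i = j then 1 else 0) + ε) :=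
        Finset.sum_le_sum fun i _ => Finset.sum_le_sum fun j _ => hbound i j
    _ = n + n ^ 2 * ε := by
        simp [Finset.sum_add_distrib, sq]
        ring

/-! ### Comparison of the expected welfares -/

theorem percentileMechanism_mem_Icc {n m : ℕ} (p : Fin m → unitInterval) {x : Fin (n + 1) → ℝ}
    (hx : ∀ i, x i ∈ Set.Icc (0 : ℝ) 1) (j : Fin m) :
    percentileMechanism p x j ∈ Set.Icc (0 : ℝ) 1 := hx _

/-- Existence of an equilibrium is essential: the supremum of an empty set would be the default
value 0. The gain `g` may be negative. -/
theorem welfareAt_add_le_optimalWelfare {n m : ℕ} {q : Fin (m + 1) → ℝ} {x : Fin n → ℝ}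
    {y : Fin (m + 1) → ℝ} (hx : ∀ i, x i ∈ Set.Icc (0 : ℝ) 1)
    (hy : ∀ j, y j ∈ Set.Icc (0 : ℝ) 1) {g : ℝ}
    (h : ∀ s, IsNashEquilibrium q x y s → socialWelfare q x y s + g ≤ optimalWelfare q x) :
    welfareAt q x y + g ≤ optimalWelfare q x := by
  obtain ⟨s, hs⟩ := exists_isNashEquilibrium q hx hy
  rw [← le_sub_iff_add_le]
  refine csSup_le ⟨_, s, hs, rfl⟩ ?_
  rintro w ⟨t, ht, rfl⟩
  linarith [h t ht]

theorem welfareAt_le {n m : ℕ} (q : Fin m → ℝ) (x : Fin n → ℝ) (y : Fin m → ℝ) :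
    welfareAt q x y ≤ n := by
  refine Real.sSup_le ?_ (Nat.cast_nonneg n)
  rintro w ⟨s, -, rfl⟩
  exact socialWelfare_le q x y s

theorem welfareAt_nonneg {n m : ℕ} (q : Fin m → ℝ) {x : Fin n → ℝ} {y : Fin m → ℝ}
    (hx : ∀ i, x i ∈ Set.Icc (0 : ℝ) 1) (hy : ∀ j, y j ∈ Set.Icc (0 : ℝ) 1) :
    0 ≤ welfareAt q x y := by
  refine Real.sSup_nonneg ?_
  rintro w ⟨s, -, rfl⟩
  refine Finset.sum_nonneg fun i _ => ?_
  unfold utility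
  split_ifs
  · linarith [abs_sub_le_one_of_mem_Icc (hx i) (hy (s i))]
  · exact le_rfl

theorem HasUniformGain.not_isAsymptoticallyOptimal {μ : Measure ℝ} [IsProbabilityMeasure μ]
    (hsupp : μ (Set.Icc (0 : ℝ) 1) = 1) (hac : μ ≪ volume) {q : Fin 2 → ℝ}
    {p : Fin 2 → unitInterval} (hgain : HasUniformGain q p) : ¬ IsAsymptoticallyOptimal μ q p := by
  intro hopt
  have : NullSingletonClass μ := ⟨fun z => hac (measure_singleton z)⟩
  obtain ⟨κ, hκ, η, hη, hgain⟩ := hgain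
  -- The mean number of close pairs is at most N + N²η²/4, which is at most (ηN)²/2 once Nη² ≥ 4.
  -- The scale δ = r / 2 is fixed only after `η`.
  have hε : 0 < η ^ 2 / 4 := by positivity
  obtain ⟨r, hr, hμr⟩ := exists_pos_measure_Icc_le μ hac (ENNReal.ofReal_pos.mpr hε).ne'
  obtain ⟨n₀, hn₀⟩ := hgain (r / 2) (by positivity)
  set c := r / 2 * κ with hc
  have hc0 : 0 < c := by positivity
  obtain ⟨n₁, hn₁⟩ := exists_nat_ge (4 / η ^ 2)
  have hev := (hopt.eventually (Ioo_mem_nhds (zero_lt_one' ℝ)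
    (by linarith : (1 : ℝ) < 1 + c / 2))).and ((eventually_ge_atTop n₀).and (eventually_ge_atTop n₁))
  obtain ⟨n, ⟨hpos, hlt⟩, hnn₀, hnn₁⟩ := hev.exists
  set ν := Measure.pi fun _ : Fin (n + 1) => μ with hν
  set N : ℝ := (n : ℝ) + 1 with hN
  have hN0 : 0 < N := by positivity
  have hNη : 4 ≤ N * η ^ 2 := by
    have h1 : 4 ≤ n * η ^ 2 := (div_le_iff₀ (by positivity)).mp (hn₁.trans (by exact_mod_cast hnn₁))
    nlinarith [sq_nonneg η]
  set I := ∫ x, optimalWelfare q x ∂ν with hI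
  set J := ∫ x, welfareAt q x (percentileMechanism p x) ∂ν with hJ
  have hratio : bayesianRatio μ q p n = I / J := rfl
  rw [hratio] at hpos hlt
  -- A ratio close to `1` forces both expectations to be nonzero, hence both welfares integrable.
  have hI0 : I ≠ 0 := by
    intro h
    simp [h] at hpos
  have hJ0 : J ≠ 0 := by
    intro h
    simp [h] at hpos
  have hIint : Integrable (fun x => optimalWelfare q x) ν := by
    by_contra h
    exact hI0 (integral_undef h)
  have hJint : Integrable (fun x => welfareAt q x (percentileMechanism p x)) ν := by
    by_contra h
    exact hJ0 (integral_undef h)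
  have hmem := ae_pi_mem_Icc (ι := Fin (n + 1)) μ hsupp
  have hinj := ae_pi_injective (ι := Fin (n + 1)) μ
  have hJpos : 0 < J := by
    refine lt_of_le_of_ne (integral_nonneg_of_ae ?_) (Ne.symm hJ0)
    filter_upwards [hmem] with x hx
    exact welfareAt_nonneg q hx (percentileMechanism_mem_Icc p hx)
  have hJN : J ≤ N := by
    have h1 : J ≤ ∫ _, N ∂ν := integral_mono hJint (integrable_const _) fun x => by
      have := welfareAt_le q x (percentileMechanism p x)
      push_cast at this
      exact this
    simpa using h1
  have hZint := integrable_closePairs r ν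
  -- One bound for all inputs: the factor is at most 1 on typical inputs, where the gain applies,
  -- and nonpositive when there are too many close pairs, where optimality suffices.
  have hpoint : ∀ᵐ x ∂ν, welfareAt q x (percentileMechanism p x) +
      c * N * (1 - closePairs r x / (η * N) ^ 2) ≤ optimalWelfare q x := by
    filter_upwards [hmem, hinj] with x hx hxinj
    have hy := percentileMechanism_mem_Icc p hx
    refine welfareAt_add_le_optimalWelfare hx hy fun s hs => ?_
    have hcN : 0 < c * N := by positivity
    have hηN : 0 < (η * N) ^ 2 := by positivity
    by_cases hZ : closePairs r x ≤ (η * N) ^ 2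
    · have hr2 : r = 2 * (r / 2) := by ring
      rw [hr2] at hZ
      have h1 := hn₀ n hnn₀ x ⟨hx, hxinj, isSpread_of_closePairs_le (by positivity) hZ⟩ s
      have h2 : 0 ≤ closePairs r x / (η * N) ^ 2 := div_nonneg (closePairs_nonneg r x) hηN.le
      nlinarith
    · have h1 := socialWelfare_le_optimalWelfare hy hs
      have h2 : 1 ≤ closePairs r x / (η * N) ^ 2 := (one_le_div hηN).mpr (not_le.mp hZ).le
      nlinarith
  have hIJ : J + c * N * (1 - (∫ x, closePairs r x ∂ν) / (η * N) ^ 2) ≤ I := by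
    have hint2 : Integrable (fun x => c * N * (1 - closePairs r x / (η * N) ^ 2)) ν :=
      ((integrable_const _).sub (hZint.div_const _)).const_mul _
    have h1 := integral_mono_ae (hJint.add hint2) hIint hpoint
    refine le_trans (le_of_eq ?_) h1
    rw [integral_add' hJint hint2, integral_const_mul,
      integral_sub (integrable_const _) (hZint.div_const _), integral_div]
    simp [hJ]
  have hZ := integral_closePairs_le (n := n + 1) μ hε.le hμr
  have hZ' : (∫ x, closePairs r x ∂ν) / (η * N) ^ 2 ≤ 1 / 2 := by
    rw [div_le_iff₀ (by positivity)]
    refine hZ.trans ?_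
    push_cast
    rw [← hN]
    nlinarith
  have hcN : 0 < c * N := by positivity
  -- Since J ≤ N, the additive gain cN/2 is at least a fraction c/2 of J.
  have hfinal : J * (1 + c / 2) ≤ I := by nlinarith
  rw [div_lt_iff₀ hJpos] at hlt
  linarith

theorem mainTheorem9 (μ : Measure ℝ) [IsProbabilityMeasure μ]
    (hsupp : μ (Set.Icc (0 : ℝ) 1) = 1) (hac : μ ≪ volume)
    (q : Fin 2 → ℝ) (hq : ∀ j, 0 < q j) (hq1 : q 0 + q 1 < 1) (hq2 : 2 / 3 < q 0 + q 1)
    (p : Fin 2 → unitInterval) (hES : IsEquilibriumStable q p) :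
    ¬ IsAsymptoticallyOptimal μ q p :=
  (hES.hasUniformGain hq hq1 hq2).not_isAsymptoticallyOptimal hsupp hac
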